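/- **The model.** Let $t\in[0,1]$ and $T_1,T_2>0$. Fix a finite set $\eta_0\subset(0,T_1]$ of *sources* and a finite set $\xi\subset(0,T_2]$ of *sinks*. The *$t$-PNG model* on $[0,T_1]\times[0,T_2]$ with these boundary data is defined as follows. Place a Poisson point process of intensity $1$ (the *nucleations*) on $[0,T_1]\times[0,T_2]$. From each nucleation a vertical line goes upward and a horizontal line goes to the right; in addition a vertical line goes upward from each point $(x,0)$, $x\in\eta_0$, and a horizontal line goes to the right from each point $(0,s)$, $s\in\xi$. Whenever a horizontal and a vertical line meet, they cross each other with probability $t$ and annihilate each other (both stop) with probability $1-t$; given the nucleations, the outcomes of the intersection points are sampled independently of each other, moving outward from the origin. The *$t$-Hammersley process* $(\eta_\tau)_{0\le\tau\le T_2}$ with sources $\eta_0$ and sinks $\xi$ is the right-continuous process of finite subsets of $[0,T_1]$ for which $\eta_\tau$ is the set of abscissas of the vertical lines present at height $\tau$. The *height function* $N(x,y)$ of the model is the right-continuous function on $[0,T_1]\times[0,T_2]$ with $N(0,0)=0$ that increases by $1$ each time a line is crossed from left to right or from bottom to top. A *coupling* of two such models is a construction of both on one probability space. **Lemma (Attractivity).**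 1. (Adding sources.) Let $\eta_0\subseteq\zeta_0\subset(0,T_1]$ and $\xi\subset(0,T_2]$ be finite. There is a coupling of the $t$-PNG model with sources $\eta_0$ and sinks $\xi$ and the $t$-PNG model with sources $\zeta_0$ and sinks $\xi$ such that, almost surely, their $t$-Hammersley processes satisfy $\eta_\tau\subseteq\zeta_\tau$ for all $\tau\in[0,T_2]$. 2. (Adding sinks.) Let $\eta_0\subset(0,T_1]$ and $\xi\subseteq\tilde\xi\subset(0,T_2]$ be finite. There is a coupling of the $t$-PNG model with sources $\eta_0$ and sinks $\xi$ and the $t$-PNG model with sources $\eta_0$ and sinks $\tilde\xi$ such that, almost surely, their $t$-Hammersley processes satisfy $$|\tilde\eta_\tau|\;\ge\;|\eta_\tau|-\big|(\tilde\xi\setminus\xi)\cap[0,\tau]\big|\qquad\text{for all }\tau\in[0,T_2].$$ 3. (Height function.) Adding sources or adding sinks weakly increases the height function under a coupling: in each of the situations 1 and 2 the coupling can be chosen so that, in addition, almost surely the height functions $N$ of the first model and $N'$ of the second model satisfy $N(x,y)\le N'(x,y)$ for all $(x,y)\in[0,T_1]\times[0,T_2]$. -/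

import Mathlib

open MeasureTheory ProbabilityTheory
open scoped Classical

namespace TPNG

noncomputable section

/-! ### The `t`-PNG picture determined by nucleations, boundary data and intersection outcomes

A point `(z, s) : ℝ × ℝ` has horizontal coordinate `z` and vertical coordinate (time) `s`.
A *configuration* is the finite set of abscissas of the vertical lines at a given height. -/

/-- The vertical lines met, from left to right, by a horizontal line that starts at abscissa `z`
when the vertical lines present are those at the points of `X`. -/
def toTheRight (z : ℝ) (X : Finset ℝ) : List ℝ :=
  (X.filter (fun x => z < x)).sort

/-- A horizontal line meets the vertical lines of the list one after the other. At its `j`-th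
intersection point the two lines cross if `c j = true` and annihilate each other if `c j = false`.
The value is the vertical line at which the horizontal line is annihilated, if there is one. -/
def annihilatedAt (c : ℕ → Bool) : List ℝ → Option ℝ
  | [] => none
  | x :: l => if c 0 then annihilatedAt (fun j => c (j + 1)) l else some x

/-- Where the horizontal line started at abscissa `z` is annihilated (`none` if it never is). -/
def endpoint (c : ℕ → Bool) (z : ℝ) (X : Finset ℝ) : Option ℝ :=
  annihilatedAt c (toTheRight z X)

/-- Effect on the configuration `X` of a nucleation at abscissa `z`: the vertical line at which the
horizontal line is annihilated disappears, and a new vertical line starts at `z`. Sinks are the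
nucleations with `z = 0`; their vertical line runs along the `y`-axis and is ignored. -/
def step (c : ℕ → Bool) (z : ℝ) (X : Finset ℝ) : Finset ℝ :=
  let Y := match endpoint c z X with
    | none => X
    | some x => X.erase x
  if 0 < z then insert z Y else Y

/-- The configuration after the nucleations of the list (in order of height) have been processed;
`c k j` is the outcome of the `j`-th intersection point on the `k`-th horizontal line. -/
def run : (ℕ → ℕ → Bool) → List (ℝ × ℝ) → Finset ℝ → Finset ℝ
  | _, [], X => X
  | c, p :: l, X => run (fun k => c (k + 1)) l (step (c 0) p.1 X)

/-- The horizontal segments: each starting point together with the abscissa where the line is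
annihilated (`none` if the line goes on forever to the right). -/
def segments : (ℕ → ℕ → Bool) → List (ℝ × ℝ) → Finset ℝ → List ((ℝ × ℝ) × Option ℝ)
  | _, [], _ => []
  | c, p :: l, X =>
      (p, endpoint (c 0) p.1 X) :: segments (fun k => c (k + 1)) l (step (c 0) p.1 X)

/-- The starting points of the horizontal lines (the nucleations `(z, s)` and the points `(0, s)`
for the sinks `s`), listed by increasing height. -/
def startingPoints (nuc : Finset (ℝ × ℝ)) (sinks : Finset ℝ) : List (ℝ × ℝ) :=
  (((nuc ∪ sinks.image (fun s => ((0 : ℝ), s))).image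
    (fun p : ℝ × ℝ => toLex (p.2, p.1))).sort).map
      (fun q => ((ofLex q).2, (ofLex q).1))

/-- A realization of the `t`-PNG model with boundary data: sources on the `x`-axis, sinks on the
`y`-axis, nucleations, and the outcomes of the intersection points (`true`: crossing point,
`false`: corner point). -/
structure Picture where
  sources : Finset ℝ
  sinks : Finset ℝ
  nuc : Finset (ℝ × ℝ)
  outcome : ℕ → ℕ → Bool

/-- The associated particle configuration at time `τ`: the abscissas of the vertical lines at height
`τ`, chosen right continuous in `τ`. -/
def Picture.particles (G : Picture) (τ : ℝ) : Finset ℝ :=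
  run G.outcome ((startingPoints G.nuc G.sinks).filter (fun p => decide (p.2 ≤ τ))) G.sources

/-- The number of vertical lines crossed when moving from left to right from `(x, y)` to
`(x', y)`. -/
def Picture.verticalCrossed (G : Picture) (y x x' : ℝ) : ℕ :=
  ((G.particles y).filter (fun p => x < p ∧ p ≤ x')).card

/-- The number of horizontal lines crossed when moving from bottom to top from `(x, y)` to
`(x, y')`. A horizontal line covers its starting abscissa, but not the abscissa at which it is
annihilated. -/
def Picture.horizontalCrossed (G : Picture) (x y y' : ℝ) : ℕ :=
  (segments G.outcome (startingPoints G.nuc G.sinks) G.sources).countP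
    (fun h => decide (y < h.1.2 ∧ h.1.2 ≤ y' ∧ h.1.1 ≤ x ∧ ∀ e ∈ h.2, x < e))

/-- `N` is the (right continuous) height function on `[0, T₁] × [0, T₂]`: it vanishes at the origin
and increases by one whenever a line is crossed from left to right or from bottom to top. -/
structure IsHeightFunction (G : Picture) (T₁ T₂ : ℝ) (N : ℝ → ℝ → ℤ) : Prop where
  origin : N 0 0 = 0
  left_to_right : ∀ y ∈ Set.Icc 0 T₂, ∀ x ∈ Set.Icc 0 T₁, ∀ x' ∈ Set.Icc x T₁,
    N x' y = N x y + G.verticalCrossed y x x'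
  bottom_to_top : ∀ x ∈ Set.Icc 0 T₁, ∀ y ∈ Set.Icc 0 T₂, ∀ y' ∈ Set.Icc y T₂,
    N x y' = N x y + G.horizontalCrossed x y y'

/-! ### The random model -/

variable {Ω : Type*} [MeasurableSpace Ω]

/-- Number of points of the finite set `s` in `B`. -/
def count (s : Finset (ℝ × ℝ)) (B : Set (ℝ × ℝ)) : ℕ := (s.filter (fun p => p ∈ B)).card

/-- The random finite set `nuc` is a Poisson point process of intensity `1` on the rectangle
`[0, T₁] × [0, T₂]`. -/
structure IsPoissonProcess (T₁ T₂ : ℝ) (P : Measure Ω) (nuc : Ω → Finset (ℝ × ℝ)) : Prop where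
  measurable : ∀ B, MeasurableSet B → Measurable (fun ω => count (nuc ω) B)
  law : ∀ B, MeasurableSet B → P.map (fun ω => count (nuc ω) B) =
    poissonMeasure (volume (B ∩ Set.Icc 0 T₁ ×ˢ Set.Icc 0 T₂)).toNNReal
  indep : ∀ (n : ℕ) (B : Fin n → Set (ℝ × ℝ)), (∀ i, MeasurableSet (B i)) →
    Pairwise (fun i j => Disjoint (B i) (B j)) →
      iIndepFun (fun i ω => count (nuc ω) (B i)) P

/-- The `t`-PNG model on the rectangle `[0, T₁] × [0, T₂]` with the given sources and sinks, defined
on the probability space `(Ω, P)`: Poisson nucleations of intensity `1` and, independently, the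
independent outcomes of the intersection points, which are crossing points with probability `t` and
corner points with probability `1 - t`. -/
structure Model (t T₁ T₂ : ℝ) (sources sinks : Finset ℝ) (P : Measure Ω) where
  nuc : Ω → Finset (ℝ × ℝ)
  outcome : ℕ → ℕ → Ω → Bool
  nuc_poisson : IsPoissonProcess T₁ T₂ P nuc
  outcome_measurable : ∀ k j, Measurable (outcome k j)
  outcome_law : ∀ k j, P {ω | outcome k j ω = true} = ENNReal.ofReal t
  outcome_indep : iIndepFun (fun (q : ℕ × ℕ) ω => outcome q.1 q.2 ω) P
  nuc_outcome_indep : IndepFun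
    (fun ω (B : {B : Set (ℝ × ℝ) // MeasurableSet B}) => count (nuc ω) B)
    (fun ω (q : ℕ × ℕ) => outcome q.1 q.2 ω) P

namespace Model

variable {t T₁ T₂ : ℝ} {sources sinks : Finset ℝ} {P : Measure Ω}

/-- The realization of the `t`-PNG model at `ω`. -/
def picture (M : Model t T₁ T₂ sources sinks P) (ω : Ω) : Picture where
  sources := sources
  sinks := sinks
  nuc := M.nuc ω
  outcome := fun k j => M.outcome k j ω

/-- The `t`-Hammersley process: the particle configuration at time `τ`. -/
def hammersley (M : Model t T₁ T₂ sources sinks P) (τ : ℝ) (ω : Ω) : Finset ℝ :=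
  (M.picture ω).particles τ

end Model

/-- The height function of `G` is at most that of `H` on `[0, T₁] × [0, T₂]` (both exist). -/
def HeightLE (T₁ T₂ : ℝ) (G H : Picture) : Prop :=
  ∃ N N' : ℝ → ℝ → ℤ, IsHeightFunction G T₁ T₂ N ∧ IsHeightFunction H T₁ T₂ N' ∧
    ∀ x ∈ Set.Icc 0 T₁, ∀ y ∈ Set.Icc 0 T₂, N x y ≤ N' x y

end

end TPNG

/-!
The two models share their nucleations, and their outcomes are built from one array of independent
outcomes in such a way that one *smaller* picture, with fewer sources and more sinks, always has
its vertical lines among those of the *larger* picture, with more sources and fewer sinks. Whenever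
a horizontal line of both pictures meets a vertical line of both pictures, the outcome is the same.

Consider the passage of a common horizontal line. If it is annihilated in the larger picture by a
vertical line of the smaller picture, then it is annihilated there in both. If it is annihilated in
the larger picture by an unmatched line, then that line disappears and the smaller picture loses at
most one line. If it survives in the larger picture, then it survives in both. In all cases the
inclusion persists and the number of unmatched lines does not increase
(`eraseOption_find?_mono`, `step_common`). A sink present in the smaller picture only removes at
most one vertical line from it, so it creates at most one unmatched line (`step_new`). Hence the
number of unmatched lines at height `τ` is at most the number of additional sources plus the number
of additional sinks up to `τ` (`particles_subPicture`). With equal sinks this is the inclusion of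
the Hammersley processes; with equal sources it is the bound on the numbers of particles. The height
at `(x, y)` is the number of sinks up to `y` plus the number of vertical lines in `(0, x]` at height
`y`: the two ways of computing it agree by conservation of lines (`flux_balance`), provided that the
abscissas of the nucleations are in general position. The comparison of the height functions
follows from the same two bounds (`heightLE_subPicture`, `heightLE_superPicture`).

What remains is that both arrays of outcomes have the right law. The outcomes of the model are
indexed by the rank of the vertical line among those met, so the coupling re-indexes each row of
the common array by an injection that depends on the nucleations and on earlier rows. For fixed
nucleations such a transformation preserves the law of the array, by induction on the list of
horizontal lines and Fubini's theorem (`measurePreserving_subOutcome`). It depends on the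
nucleations through finitely many order comparisons only (`outcome_eq_of_nucPattern_eq`), whence it
is jointly measurable; as a skew product over the nucleations it yields an array with the right law
that is independent of them (`transformedModel`).

The Poisson process consists of a Poisson number of independent uniform points; its law is
identified by the joint characteristic function of the numbers of points in disjoint sets
(`integral_exp_multCount`).
-/

namespace TPNG

/-! ### Coupling two pictures row by row -/

/-- Prepends a row to an array of outcomes. -/
def consRow {α : Type*} (r : α) (f : ℕ → α) : ℕ → α
  | 0 => r
  | k + 1 => f k

@[simp] lemma consRow_zero {α : Type*} (r : α) (f : ℕ → α) : consRow r f 0 = r := rfl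
@[simp] lemma consRow_succ {α : Type*} (r : α) (f : ℕ → α) (k : ℕ) :
    consRow r f (k + 1) = f k := rfl

/-- For a list `l` of lines contained in the list `l'`, the index in `l'` of the `j`-th line of `l`.
Beyond the end of `l` the values are chosen past the end of `l'`, so that the map is injective. -/
noncomputable def relabel (l l' : List ℝ) (j : ℕ) : ℕ :=
  if h : j < l.length then l'.idxOf l[j] else l'.length + j

lemma relabel_injective {l l' : List ℝ} (hl : l.Nodup) (h : l ⊆ l') :
    Function.Injective (relabel l l') := by
  intro i j hij
  unfold relabel at hij
  split_ifs at hij with hi hj hj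
  · have hi' := h (List.getElem_mem hi)
    have := (List.idxOf_inj hi').1 hij
    exact (hl.getElem_inj_iff).1 this
  · have := List.idxOf_lt_length_iff.2 (h (List.getElem_mem hi))
    omega
  · have := List.idxOf_lt_length_iff.2 (h (List.getElem_mem hj))
    omega
  · omega

/-- The outcomes on a horizontal line of the smaller picture: at a vertical line present in both
pictures they agree with the outcomes `c` of the larger picture. -/
noncomputable def relabelledRow (c : ℕ → Bool) (z : ℝ) (X Y : Finset ℝ) (j : ℕ) : Bool :=
  c (relabel (toTheRight z X) (toTheRight z Y) j)

/-- Outcomes of the picture with the larger set of particles. The flag tells whether a row of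
`d` belongs to a horizontal line of this picture; the other rows are skipped. -/
def superOutcome : (ℕ → ℕ → Bool) → List (ℝ × Bool) → ℕ → ℕ → Bool
  | d, [] => d
  | d, p :: l =>
    if p.2 then consRow (d 0) (superOutcome (fun k => d (k + 1)) l)
    else superOutcome (fun k => d (k + 1)) l

/-- Outcomes of the picture with the smaller set of particles `X`, all of whose horizontal lines are
listed. A line with flag `true` is shared with the picture with particles `Y`, and its row
is relabelled; a line with flag `false` is present in the smaller picture only. -/
noncomputable def subOutcome :
    (ℕ → ℕ → Bool) → List (ℝ × Bool) → Finset ℝ → Finset ℝ → ℕ → ℕ → Bool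
  | d, [], _, _ => d
  | d, p :: l, X, Y =>
    if p.2 then
      consRow (relabelledRow (d 0) p.1 X Y)
        (subOutcome (fun k => d (k + 1)) l (step (relabelledRow (d 0) p.1 X Y) p.1 X)
          (step (d 0) p.1 Y))
    else consRow (d 0) (subOutcome (fun k => d (k + 1)) l (step (d 0) p.1 X) Y)

lemma mem_toTheRight {z x : ℝ} {X : Finset ℝ} : x ∈ toTheRight z X ↔ x ∈ X ∧ z < x := by
  simp [toTheRight]

lemma nodup_toTheRight (z : ℝ) (X : Finset ℝ) : (toTheRight z X).Nodup :=
  Finset.sort_nodup _ _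

lemma toTheRight_subset {z : ℝ} {X Y : Finset ℝ} (h : X ⊆ Y) : toTheRight z X ⊆ toTheRight z Y :=
  fun _ hx => mem_toTheRight.2 ⟨h (mem_toTheRight.1 hx).1, (mem_toTheRight.1 hx).2⟩

/-- Once the outcomes are read as a function `b` of the vertical line instead of its rank, the line
of annihilation is the first one with outcome `false`. -/
lemma annihilatedAt_eq_find? (b : ℝ → Bool) (l : List ℝ) (c : ℕ → Bool)
    (h : ∀ j (hj : j < l.length), c j = b l[j]) :
    annihilatedAt c l = l.find? (fun x => !b x) := by
  induction l generalizing c with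
  | nil => rfl
  | cons x l ih =>
    have h0 : c 0 = b x := h 0 (by simp)
    have := ih (fun j => c (j + 1)) (fun j hj => h (j + 1) (by simpa using hj))
    rw [annihilatedAt, List.find?_cons, this, h0]
    cases b x <;> simp

/-- The row `c` read as a function of the vertical lines of `Y` met from `z`. -/
noncomputable def outcomeAt (c : ℕ → Bool) (z : ℝ) (Y : Finset ℝ) (x : ℝ) : Bool :=
  c ((toTheRight z Y).idxOf x)

lemma endpoint_eq_find? (c : ℕ → Bool) (z : ℝ) (Y : Finset ℝ) :
    endpoint c z Y = (toTheRight z Y).find? (fun x => !outcomeAt c z Y x) := by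
  refine annihilatedAt_eq_find? _ _ _ fun j hj => ?_
  simp [outcomeAt, (nodup_toTheRight z Y).idxOf_getElem]

/-- The outcomes in the smaller picture are the same function of the vertical line as in the larger
one. -/
lemma endpoint_relabelledRow (c : ℕ → Bool) (z : ℝ) (X Y : Finset ℝ) :
    endpoint (relabelledRow c z X Y) z X =
      (toTheRight z X).find? (fun x => !outcomeAt c z Y x) := by
  refine annihilatedAt_eq_find? _ _ _ fun j hj => ?_
  simp [outcomeAt, relabelledRow, relabel, hj]

lemma find?_toTheRight_eq_some {b : ℝ → Bool} {z x : ℝ} {X : Finset ℝ} :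
    (toTheRight z X).find? b = some x ↔
      x ∈ X ∧ z < x ∧ b x = true ∧ ∀ y ∈ X, z < y → y < x → b y = false := by
  rw [List.find?_eq_some_iff_append]
  constructor
  · rintro ⟨hb, l₁, l₂, hl, h⟩
    have hx : x ∈ toTheRight z X := by simp [hl]
    refine ⟨(mem_toTheRight.1 hx).1, (mem_toTheRight.1 hx).2, hb, fun y hy hzy hyx => ?_⟩
    have hy' : y ∈ toTheRight z X := mem_toTheRight.2 ⟨hy, hzy⟩
    have hs : (toTheRight z X).Pairwise (· ≤ ·) := Finset.pairwise_sort _ _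
    rw [hl] at hy' hs
    rcases List.mem_append.1 hy' with hy' | hy'
    · simpa using h y hy'
    · have := (List.pairwise_cons.1 (List.pairwise_append.1 hs).2.1).1
      rcases List.mem_cons.1 hy' with rfl | hy'
      · exact absurd hyx (lt_irrefl _)
      · exact absurd hyx (this y hy').not_gt
  · rintro ⟨hx, hzx, hb, h⟩
    obtain ⟨l₁, l₂, hl⟩ := List.append_of_mem (mem_toTheRight.2 ⟨hx, hzx⟩)
    refine ⟨hb, l₁, l₂, hl, fun a ha => ?_⟩
    have ha' : a ∈ toTheRight z X := by simp [hl, ha]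
    have hs : (toTheRight z X).SortedLT := Finset.sortedLT_sort _
    rw [hl] at hs
    have := (List.pairwise_append.1 hs.pairwise).2.2 a ha x (by simp)
    simpa using h a (mem_toTheRight.1 ha').1 (mem_toTheRight.1 ha').2 this

lemma mem_of_endpoint_eq_some {c : ℕ → Bool} {z x : ℝ} {X : Finset ℝ}
    (h : endpoint c z X = some x) : x ∈ X ∧ z < x := by
  rw [endpoint_eq_find?, find?_toTheRight_eq_some] at h
  exact ⟨h.1, h.2.1⟩

/-- The vertical lines that survive the passage of a horizontal line annihilated at `e`. -/
noncomputable def eraseOption (e : Option ℝ) (X : Finset ℝ) : Finset ℝ :=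
  e.elim X fun x => X.erase x

lemma step_eq (c : ℕ → Bool) (z : ℝ) (X : Finset ℝ) :
    step c z X = if 0 < z then insert z (eraseOption (endpoint c z X) X)
      else eraseOption (endpoint c z X) X := by
  unfold step eraseOption
  cases endpoint c z X <;> simp

/-- A horizontal line that meets two families of vertical lines, one contained in the other, with
common outcomes: the inclusion persists, and the number of unmatched lines does not grow. Indeed, if
the smaller family loses `x` and the larger one does not, then the latter loses an unmatched line,
and `x` takes its place. -/
lemma eraseOption_find?_mono {X Y : Finset ℝ} (h : X ⊆ Y) (b : ℝ → Bool) (z : ℝ) :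
    let X' := eraseOption ((toTheRight z X).find? b) X
    let Y' := eraseOption ((toTheRight z Y).find? b) Y
    X' ⊆ Y' ∧ (Y' \ X').card ≤ (Y \ X).card := by
  intro X' Y'
  rcases hY : (toTheRight z Y).find? b with _ | y
  · have hX : (toTheRight z X).find? b = none := by
      rw [List.find?_eq_none] at hY ⊢
      exact fun x hx => hY x (toTheRight_subset h hx)
    simp only [X', Y', hX, hY, eraseOption, Option.elim]
    exact ⟨h, le_rfl⟩
  · have hY2 := find?_toTheRight_eq_some.1 hY
    by_cases hyX : y ∈ X
    · have hX : (toTheRight z X).find? b = some y :=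
        find?_toTheRight_eq_some.2 ⟨hyX, hY2.2.1, hY2.2.2.1, fun u hu => hY2.2.2.2 u (h hu)⟩
      simp only [X', Y', hX, hY, eraseOption, Option.elim]
      refine ⟨Finset.erase_subset_erase _ h, Finset.card_le_card fun u hu => ?_⟩
      simp only [Finset.mem_sdiff, Finset.mem_erase] at hu ⊢
      tauto
    · have hX' : X' ⊆ X := by
        simp only [X', eraseOption]
        cases (toTheRight z X).find? b with
        | none => exact subset_rfl
        | some x => exact Finset.erase_subset _ _
      have hcard : X.card ≤ X'.card + 1 := by
        simp only [X', eraseOption]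
        cases (toTheRight z X).find? b with
        | none => simp
        | some x =>
          have := Finset.pred_card_le_card_erase (s := X) (a := x)
          simp only [Option.elim]
          omega
      have hY' : Y' = Y.erase y := by simp only [Y', hY, eraseOption, Option.elim]
      have hsub : X' ⊆ Y' := by
        rw [hY']
        exact fun u hu => Finset.mem_erase.2
          ⟨fun huy => hyX (huy ▸ hX' hu), h (hX' hu)⟩
      refine ⟨hsub, ?_⟩
      rw [Finset.card_sdiff_of_subset hsub, Finset.card_sdiff_of_subset h, hY',
        Finset.card_erase_of_mem hY2.1]
      omega

/-- A common horizontal line with relabelled outcomes keeps the inclusion and does not increase the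
number of unmatched lines. The new vertical line at `z` belongs to both pictures. -/
lemma step_common {X Y : Finset ℝ} (h : X ⊆ Y) (c : ℕ → Bool) (z : ℝ) :
    step (relabelledRow c z X Y) z X ⊆ step c z Y ∧
      (step c z Y \ step (relabelledRow c z X Y) z X).card ≤ (Y \ X).card := by
  have key := eraseOption_find?_mono h (fun x => !outcomeAt c z Y x) z
  simp only [step_eq, endpoint_relabelledRow, endpoint_eq_find? c z Y]
  split_ifs
  · refine ⟨Finset.insert_subset_insert _ key.1, le_trans (Finset.card_le_card ?_) key.2⟩
    intro u hu
    simp only [Finset.mem_sdiff, Finset.mem_insert] at hu ⊢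
    tauto
  · exact key

/-- A sink of the smaller picture only: it removes at most one vertical line and creates none. -/
lemma step_new {X Y : Finset ℝ} (h : X ⊆ Y) (c : ℕ → Bool) {z : ℝ} (hz : ¬ 0 < z) :
    step c z X ⊆ Y ∧ (Y \ step c z X).card ≤ (Y \ X).card + 1 := by
  rw [step_eq, if_neg hz]
  cases endpoint c z X with
  | none => exact ⟨h, Nat.le_succ _⟩
  | some x =>
    have hsub : X.erase x ⊆ Y := (Finset.erase_subset _ _).trans h
    refine ⟨hsub, ?_⟩
    simp only [eraseOption, Option.elim]
    rw [Finset.card_sdiff_of_subset hsub, Finset.card_sdiff_of_subset h]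
    have := Finset.pred_card_le_card_erase (s := X) (a := x)
    omega

/-- The horizontal lines as the coupling sees them: abscissa of the starting point and flag. -/
def flagged (q : ℝ × ℝ → Bool) (l : List (ℝ × ℝ)) : List (ℝ × Bool) := l.map fun p => (p.1, q p)

/-- The coupled particle systems stay ordered, and the number of unmatched particles grows by at
most one with each line that is present in the smaller picture only. The prefix `A` of the list of
horizontal lines stands for the lines up to a given height. -/
theorem run_subOutcome_subset (q : ℝ × ℝ → Bool) (l A : List (ℝ × ℝ)) (hA : A <+: l)
    (hq : ∀ p ∈ l, q p = false → ¬ 0 < p.1) (d : ℕ → ℕ → Bool) {X Y : Finset ℝ} (h : X ⊆ Y) :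
    run (subOutcome d (flagged q l) X Y) A X ⊆
        run (superOutcome d (flagged q l)) (A.filter q) Y ∧
      (run (superOutcome d (flagged q l)) (A.filter q) Y \
        run (subOutcome d (flagged q l) X Y) A X).card ≤
        (Y \ X).card + A.countP (fun p => !q p) := by
  induction l generalizing A d X Y with
  | nil =>
    obtain rfl := List.prefix_nil.1 hA
    simpa [run] using h
  | cons p l ih =>
    cases A with
    | nil => simpa [run] using h
    | cons p' A =>
      obtain ⟨rfl, hA'⟩ := List.cons_prefix_cons.1 hA
      have hq' : ∀ p ∈ l, q p = false → ¬ 0 < p.1 := fun p hp => hq p (by simp [hp])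
      cases hp : q p' with
      | true =>
        have hs := step_common h (d 0) p'.1
        have := ih A hA' hq' (fun k => d (k + 1)) hs.1
        simp only [flagged, List.map_cons, subOutcome, superOutcome, hp, if_true,
          List.filter_cons, run, consRow_zero, consRow_succ, List.countP_cons] at this ⊢
        refine ⟨this.1, this.2.trans ?_⟩
        have := hs.2
        simp
        omega
      | false =>
        have hs := step_new h (d 0) (hq p' (by simp) hp)
        have := ih A hA' hq' (fun k => d (k + 1)) hs.1
        simp only [flagged, List.map_cons, subOutcome, superOutcome, hp,
          Bool.false_eq_true, if_false, List.filter_cons, run, consRow_zero, consRow_succ,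
          List.countP_cons] at this ⊢
        refine ⟨this.1, this.2.trans ?_⟩
        have := hs.2
        simp
        omega

/-! ### Starting points of the horizontal lines -/

/-- The set of starting points of the horizontal lines. -/
noncomputable def startSet (nuc : Finset (ℝ × ℝ)) (sinks : Finset ℝ) : Finset (ℝ × ℝ) :=
  nuc ∪ sinks.image (fun s => ((0 : ℝ), s))

lemma mem_startSet {nuc : Finset (ℝ × ℝ)} {sinks : Finset ℝ} {p : ℝ × ℝ} :
    p ∈ startSet nuc sinks ↔ p ∈ nuc ∨ p.1 = 0 ∧ p.2 ∈ sinks := by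
  obtain ⟨z, s⟩ := p
  simp [startSet, eq_comm, and_comm]

lemma mem_startingPoints {nuc : Finset (ℝ × ℝ)} {sinks : Finset ℝ} {p : ℝ × ℝ} :
    p ∈ startingPoints nuc sinks ↔ p ∈ startSet nuc sinks := by
  simp only [startingPoints, List.mem_map, Finset.mem_sort, Finset.mem_image, startSet]
  constructor
  · rintro ⟨_, ⟨p', hp', rfl⟩, rfl⟩
    exact hp'
  · intro hp
    exact ⟨_, ⟨p, hp, rfl⟩, rfl⟩

/-- The order in which starting points are listed: by height, then by abscissa. -/
def startLE (p p' : ℝ × ℝ) : Prop := toLex (p.2, p.1) ≤ toLex (p'.2, p'.1)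

lemma startLE_iff {p p' : ℝ × ℝ} : startLE p p' ↔ p.2 < p'.2 ∨ p.2 = p'.2 ∧ p.1 ≤ p'.1 :=
  Prod.Lex.toLex_le_toLex

lemma pairwise_startingPoints (nuc : Finset (ℝ × ℝ)) (sinks : Finset ℝ) :
    (startingPoints nuc sinks).Pairwise startLE := by
  refine List.pairwise_map.2 ((Finset.pairwise_sort _ (· ≤ ·)).imp fun h => ?_)
  exact h

lemma nodup_startingPoints (nuc : Finset (ℝ × ℝ)) (sinks : Finset ℝ) :
    (startingPoints nuc sinks).Nodup := by
  refine (Finset.sort_nodup _ _).map fun a b h => ?_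
  simp only [Prod.mk.injEq] at h
  exact ofLex.injective (Prod.ext h.2 h.1)

instance : Std.Antisymm startLE :=
  ⟨fun p p' h h' => by
    have := toLex.injective (le_antisymm h h')
    simp only [Prod.mk.injEq] at this
    exact Prod.ext this.2 this.1⟩

lemma eq_startingPoints_of_pairwise {nuc : Finset (ℝ × ℝ)} {sinks : Finset ℝ} {l : List (ℝ × ℝ)}
    (hl : l.Pairwise startLE) (hn : l.Nodup) (hm : ∀ p, p ∈ l ↔ p ∈ startSet nuc sinks) :
    l = startingPoints nuc sinks :=
  ((List.perm_ext_iff_of_nodup hn (nodup_startingPoints _ _)).2 fun p => by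
    rw [hm, mem_startingPoints]).eq_of_pairwise' hl (pairwise_startingPoints _ _)

/-- Removing sinks removes their horizontal lines from the list and keeps the order. -/
lemma filter_startingPoints {nuc : Finset (ℝ × ℝ)} {sinks sinks' : Finset ℝ}
    (h : sinks ⊆ sinks') :
    (startingPoints nuc sinks').filter (fun p => decide (p ∈ startSet nuc sinks)) =
      startingPoints nuc sinks := by
  refine eq_startingPoints_of_pairwise ((pairwise_startingPoints _ _).filter _)
    ((nodup_startingPoints _ _).filter _) fun p => ?_
  rw [List.mem_filter, mem_startingPoints, decide_eq_true_iff]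
  refine ⟨fun hp => hp.2, fun hp => ⟨?_, hp⟩⟩
  rw [mem_startSet] at hp ⊢
  exact hp.imp_right fun hp => ⟨hp.1, h hp.2⟩

lemma filter_le_prefix {l : List (ℝ × ℝ)} (hl : l.Pairwise startLE) (τ : ℝ) :
    l.filter (fun p => decide (p.2 ≤ τ)) <+: l := by
  induction l with
  | nil => simp
  | cons p l ih =>
    obtain ⟨hp, hl⟩ := List.pairwise_cons.1 hl
    by_cases h : p.2 ≤ τ
    · rw [List.filter_cons_of_pos (by simpa using h)]
      exact List.cons_prefix_cons.2 ⟨rfl, ih hl⟩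
    · have : (p :: l).filter (fun p => decide (p.2 ≤ τ)) = [] := by
        rw [List.filter_eq_nil_iff]
        intro p' hp'
        rcases List.mem_cons.1 hp' with rfl | hp'
        · simpa using h
        · have := startLE_iff.1 (hp p' hp')
          simp only [decide_eq_true_eq, not_le]
          rcases this with h' | h' <;> linarith [not_le.1 h]
      simp [this]

lemma countP_startingPoints (nuc : Finset (ℝ × ℝ)) (sinks : Finset ℝ) (r : ℝ × ℝ → Bool) :
    (startingPoints nuc sinks).countP r =
      ((startSet nuc sinks).filter fun p => r p = true).card := by
  rw [List.countP_eq_length_filter,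
    ← List.toFinset_card_of_nodup ((nodup_startingPoints _ _).filter _)]
  congr 1
  ext p
  simp [mem_startingPoints]

/-! ### Existence of height functions -/

/-- The horizontal segment `h` covers the abscissa `x`. As in `Picture.horizontalCrossed`, the
starting point is covered and the point of annihilation is not. -/
def Covers (x : ℝ) (h : (ℝ × ℝ) × Option ℝ) : Prop := h.1.1 ≤ x ∧ ∀ e ∈ h.2, x < e

/-- Number of vertical lines of `X` at abscissas in `(0, x]`. -/
noncomputable def numLE (x : ℝ) (X : Finset ℝ) : ℕ := (X.filter fun p => 0 < p ∧ p ≤ x).card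

lemma numLE_insert {x z : ℝ} {X : Finset ℝ} (hz : 0 < z) (hzX : z ∉ X) :
    numLE x (insert z X) = numLE x X + if z ≤ x then 1 else 0 := by
  unfold numLE
  rw [Finset.filter_insert]
  split_ifs with h1 h2 h2
  · rw [Finset.card_insert_of_notMem (by simp [hzX])]
  · exact absurd h1.2 h2
  · exact absurd ⟨hz, h2⟩ h1
  · rfl

/-- A horizontal line that starts at or before `x` either covers `x` or removes a vertical line from
`(0, x]`, but not both. -/
lemma numLE_eraseOption {x z : ℝ} {X : Finset ℝ} {c : ℕ → Bool} (hX : ∀ p ∈ X, 0 < p) :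
    numLE x (eraseOption (endpoint c z X) X) + (if z ≤ x then 1 else 0) =
      numLE x X + if Covers x ((z, 0), endpoint c z X) then 1 else 0 := by
  cases he : endpoint c z X with
  | none => simp [eraseOption, Covers]
  | some e =>
    obtain ⟨heX, hze⟩ := mem_of_endpoint_eq_some he
    simp only [eraseOption, Option.elim, Covers, Option.mem_some_iff, forall_eq']
    unfold numLE
    rw [Finset.filter_erase]
    by_cases hex : e ≤ x
    · have hmem : e ∈ X.filter fun p => 0 < p ∧ p ≤ x := by simp [heX, hX e heX, hex]
      have hpos := Finset.card_pos.2 ⟨e, hmem⟩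
      rw [Finset.card_erase_of_mem hmem, if_pos (by linarith), if_neg (by simp [hex])]
      omega
    · rw [Finset.erase_eq_of_notMem (by simp [hex])]
      simp [not_le.1 hex]

/-- Abscissas in general position relative to a set of vertical lines: they are nonnegative, and the
positive ones are distinct and not in the set. -/
def Generic (l : List (ℝ × ℝ)) (X : Finset ℝ) : Prop :=
  (∀ x ∈ X, 0 < x) ∧ (∀ p ∈ l, 0 ≤ p.1) ∧ (∀ p ∈ l, p.1 ∉ X) ∧
    l.Pairwise fun p p' => 0 < p.1 → p.1 ≠ p'.1

lemma eraseOption_subset (e : Option ℝ) (X : Finset ℝ) : eraseOption e X ⊆ X := by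
  cases e with
  | none => exact subset_rfl
  | some x => exact Finset.erase_subset _ _

lemma Generic.step {p : ℝ × ℝ} {l : List (ℝ × ℝ)} {X : Finset ℝ} (h : Generic (p :: l) X)
    (c : ℕ → Bool) : Generic l (step c p.1 X) := by
  obtain ⟨h1, h2, h3, h4⟩ := h
  rw [List.pairwise_cons] at h4
  have hsub := eraseOption_subset (endpoint c p.1 X) X
  rw [step_eq]
  refine ⟨fun x hx => ?_, fun p' hp' => h2 p' (by simp [hp']), fun p' hp' hx => ?_, h4.2⟩
  · split_ifs at hx with hp
    · rcases Finset.mem_insert.1 hx with rfl | hx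
      · exact hp
      · exact h1 x (hsub hx)
    · exact h1 x (hsub hx)
  · split_ifs at hx with hp
    · rcases Finset.mem_insert.1 hx with hx | hx
      · exact h4.1 p' hp' hp hx.symm
      · exact h3 p' (by simp [hp']) (hsub hx)
    · exact h3 p' (by simp [hp']) (hsub hx)

/-- Conservation of lines: each horizontal line that crosses the abscissa `x` without having entered
at abscissa `0` adds a vertical line in `(0, x]`, and each one that entered at `0` without crossing
`x` removes one. -/
lemma flux_balance {l : List (ℝ × ℝ)} {X : Finset ℝ} (h : Generic l X) (c : ℕ → ℕ → Bool) {x : ℝ}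
    (hx : 0 ≤ x) :
    (segments c l X).countP (fun h => decide (Covers x h)) + numLE x X =
      numLE x (run c l X) + (segments c l X).countP (fun h => decide (Covers 0 h)) := by
  induction l generalizing c X with
  | nil => simp [segments, run]
  | cons p l ih =>
    have ih := ih (h.step (c 0)) (fun k => c (k + 1))
    have he := numLE_eraseOption (x := x) (z := p.1) (c := c 0) h.1
    have hcov : ∀ u, Covers u (p, endpoint (c 0) p.1 X) ↔
        Covers u ((p.1, 0), endpoint (c 0) p.1 X) :=
      fun u => Iff.rfl
    simp only [segments, run, List.countP_cons, decide_eq_true_eq, hcov]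
    rw [step_eq] at ih ⊢
    rcases (h.2.1 p (by simp)).lt_or_eq with hp | hp
    · have h0 : ¬ Covers 0 ((p.1, 0), endpoint (c 0) p.1 X) := fun hc => hc.1.not_gt hp
      rw [if_pos hp] at ih ⊢
      rw [numLE_insert hp fun hm => h.2.2.1 p (by simp) (eraseOption_subset _ _ hm)] at ih
      rw [if_neg h0]
      omega
    · have h0 : Covers 0 ((p.1, 0), endpoint (c 0) p.1 X) :=
        ⟨hp.ge, fun e he => hp ▸ (mem_of_endpoint_eq_some he).2⟩
      rw [if_neg hp.not_lt] at ih ⊢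
      rw [if_pos h0]
      rw [if_pos (hp ▸ hx)] at he
      omega

lemma fst_mem_of_mem_segments {c : ℕ → ℕ → Bool} {l : List (ℝ × ℝ)} {X : Finset ℝ}
    {h : (ℝ × ℝ) × Option ℝ} (hh : h ∈ segments c l X) : h.1 ∈ l := by
  induction l generalizing c X with
  | nil => simp [segments] at hh
  | cons p l ih =>
    rcases List.mem_cons.1 hh with rfl | hh
    · simp
    · exact List.mem_cons_of_mem _ (ih hh)

lemma countP_segments_le {l : List (ℝ × ℝ)} (hl : l.Pairwise startLE) (c : ℕ → ℕ → Bool)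
    (X : Finset ℝ) (x τ : ℝ) :
    (segments c l X).countP (fun h => decide (h.1.2 ≤ τ ∧ Covers x h)) =
      (segments c (l.filter fun p => decide (p.2 ≤ τ)) X).countP
        (fun h => decide (Covers x h)) := by
  induction l generalizing c X with
  | nil => simp [segments]
  | cons p l ih =>
    have hl' := List.pairwise_cons.1 hl
    by_cases h : p.2 ≤ τ
    · rw [List.filter_cons_of_pos (by simpa using h)]
      simp [segments, List.countP_cons, ih hl'.2, h, -Bool.decide_and]
    · have hlt : ∀ p' ∈ p :: l, τ < p'.2 := by
        intro p' hp'
        rcases List.mem_cons.1 hp' with rfl | hp'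
        · exact not_le.1 h
        · rcases startLE_iff.1 (hl'.1 p' hp') with h' | h' <;> linarith [not_le.1 h]
      have h1 : (p :: l).filter (fun p => decide (p.2 ≤ τ)) = [] :=
        List.filter_eq_nil_iff.2 fun p' hp' => by simpa using hlt p' hp'
      rw [h1, segments, List.countP_nil, List.countP_eq_zero]
      intro g hg
      have := hlt _ (fst_mem_of_mem_segments hg)
      simp only [decide_eq_true_eq, not_and]
      intro h'
      linarith

lemma countP_Ioc_add {α : Type*} (l : List α) (f : α → ℝ) (r : α → Prop) {y y' : ℝ} (hy : y ≤ y') :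
    l.countP (fun a => decide (y < f a ∧ f a ≤ y' ∧ r a)) +
        l.countP (fun a => decide (f a ≤ y ∧ r a)) =
      l.countP (fun a => decide (f a ≤ y' ∧ r a)) := by
  induction l with
  | nil => simp
  | cons a l ih =>
    simp only [List.countP_cons, decide_eq_true_eq]
    by_cases hr : r a
    · rcases le_or_gt (f a) y with h1 | h1
      · simp only [h1, hr, h1.not_gt, h1.trans hy, and_self, if_true, false_and, if_false]
        omega
      · by_cases h2 : f a ≤ y'
        · simp only [h1, hr, h1.not_ge, h2, and_self, if_true, false_and, if_false]
          omega
        · simp only [h1, hr, h1.not_ge, h2, false_and, and_false, if_false]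
          omega
    · simp only [hr, and_false, if_false]
      omega

/-- The horizontal lines that cover the abscissa `x` and lie at height at most `τ`. -/
noncomputable def Picture.coverCount (G : Picture) (x τ : ℝ) : ℕ :=
  (segments G.outcome ((startingPoints G.nuc G.sinks).filter fun p => decide (p.2 ≤ τ))
    G.sources).countP (fun h => decide (Covers x h))

lemma Picture.horizontalCrossed_add (G : Picture) (x : ℝ) {y y' : ℝ} (hy : y ≤ y') :
    G.horizontalCrossed x y y' + G.coverCount x y = G.coverCount x y' := by
  unfold coverCount
  rw [← countP_segments_le (pairwise_startingPoints _ _),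
    ← countP_segments_le (pairwise_startingPoints _ _)]
  rw [← countP_Ioc_add _ (fun h : (ℝ × ℝ) × Option ℝ => h.1.2) (Covers x) hy]
  exact congrArg (· + _) (List.countP_congr fun g _ => by simp [Covers])

lemma Generic.filter {l : List (ℝ × ℝ)} {X : Finset ℝ} (h : Generic l X) (r : ℝ × ℝ → Bool) :
    Generic (l.filter r) X :=
  ⟨h.1, fun p hp => h.2.1 p (List.mem_of_mem_filter hp),
    fun p hp => h.2.2.1 p (List.mem_of_mem_filter hp), h.2.2.2.filter _⟩

/-- A picture in general position: the boundary data and the abscissas of the nucleations are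
positive, and the latter are distinct from one another and from the sources. -/
structure Picture.IsGeneric (G : Picture) : Prop where
  sources_pos : ∀ x ∈ G.sources, 0 < x
  sinks_pos : ∀ s ∈ G.sinks, 0 < s
  nuc_pos : ∀ p ∈ G.nuc, 0 < p.1
  nuc_notMem : ∀ p ∈ G.nuc, p.1 ∉ G.sources
  nuc_inj : ∀ p ∈ G.nuc, ∀ p' ∈ G.nuc, p.1 = p'.1 → p = p'

lemma Picture.IsGeneric.generic {G : Picture} (h : G.IsGeneric) :
    Generic (startingPoints G.nuc G.sinks) G.sources := by
  have hcase : ∀ p ∈ startingPoints G.nuc G.sinks, p ∈ G.nuc ∨ p.1 = 0 ∧ p.2 ∈ G.sinks :=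
    fun p hp => mem_startSet.1 (mem_startingPoints.1 hp)
  refine ⟨h.sources_pos, fun p hp => ?_, fun p hp hX => ?_, ?_⟩
  · rcases hcase p hp with hp | hp
    · exact (h.nuc_pos p hp).le
    · exact hp.1.ge
  · rcases hcase p hp with hp | hp
    · exact h.nuc_notMem p hp hX
    · exact (h.sources_pos _ hX).ne' hp.1
  · refine (nodup_startingPoints _ _).imp_of_mem fun {p p'} hp hp' hne h0 heq => hne ?_
    rcases hcase p hp with hp | hp
    · rcases hcase p' hp' with hp' | hp'
      · exact h.nuc_inj p hp p' hp' heq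
      · exact absurd (heq.trans hp'.1) h0.ne'
    · exact absurd hp.1 h0.ne'

/-- The height at `(x, y)`, computed along the path through `(0, y)`. -/
noncomputable def Picture.height (G : Picture) (x y : ℝ) : ℤ :=
  numLE x (G.particles y) + G.horizontalCrossed 0 0 y

lemma Picture.IsGeneric.isHeightFunction {G : Picture} (h : G.IsGeneric) (T₁ T₂ : ℝ) :
    IsHeightFunction G T₁ T₂ G.height where
  origin := by
    have h1 : numLE 0 (G.particles 0) = 0 := by
      rw [numLE, Finset.card_eq_zero, Finset.filter_eq_empty_iff]
      rintro x - ⟨h1, h2⟩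
      linarith
    have h2 := G.horizontalCrossed_add 0 (le_refl (0 : ℝ))
    rw [height, h1]
    simp only [Nat.cast_zero, zero_add, Nat.cast_eq_zero]
    omega
  left_to_right y _ x hx x' hx' := by
    have : numLE x' (G.particles y) = numLE x (G.particles y) + G.verticalCrossed y x x' := by
      unfold numLE verticalCrossed
      rw [← Finset.card_union_of_disjoint]
      · congr 1
        ext p
        simp only [Finset.mem_filter, Finset.mem_union]
        constructor
        · rintro ⟨hp, h0, hpx⟩
          rcases le_or_gt p x with h' | h'
          · exact Or.inl ⟨hp, h0, h'⟩
          · exact Or.inr ⟨hp, h', hpx⟩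
        · rintro (⟨hp, h0, hpx⟩ | ⟨hp, h0, hpx⟩)
          · exact ⟨hp, h0, hpx.trans hx'.1⟩
          · exact ⟨hp, hx.1.trans_lt h0, hpx⟩
      · rw [Finset.disjoint_filter]
        rintro p - ⟨_, h1⟩ ⟨h2, _⟩
        linarith
    simp only [height, this]
    push_cast
    ring
  bottom_to_top x hx y hy y' hy' := by
    have b1 := flux_balance (h.generic.filter fun p => decide (p.2 ≤ y)) G.outcome hx.1
    have b2 := flux_balance (h.generic.filter fun p => decide (p.2 ≤ y')) G.outcome hx.1
    have a1 := G.horizontalCrossed_add x hy'.1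
    have a2 := G.horizontalCrossed_add 0 hy.1
    have a3 := G.horizontalCrossed_add 0 (hy.1.trans hy'.1)
    unfold height particles
    unfold coverCount at a1 a2 a3
    omega

lemma countP_segments_fst (r : ℝ × ℝ → Bool) (c : ℕ → ℕ → Bool) (l : List (ℝ × ℝ)) (X : Finset ℝ) :
    (segments c l X).countP (fun h => r h.1) = l.countP r := by
  induction l generalizing c X with
  | nil => rfl
  | cons p l ih => simp [segments, List.countP_cons, ih]

lemma endpoint_pos_of_mem_segments {c : ℕ → ℕ → Bool} {l : List (ℝ × ℝ)} {X : Finset ℝ}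
    {h : (ℝ × ℝ) × Option ℝ} (hh : h ∈ segments c l X) : ∀ e ∈ h.2, h.1.1 < e := by
  induction l generalizing c X with
  | nil => simp [segments] at hh
  | cons p l ih =>
    rcases List.mem_cons.1 hh with rfl | hh
    · exact fun e he => (mem_of_endpoint_eq_some he).2
    · exact ih hh

/-- In general position only the sinks have their horizontal lines start at abscissa `0`, and none
of these is annihilated there. -/
lemma Picture.IsGeneric.horizontalCrossed_zero {G : Picture} (h : G.IsGeneric) (y : ℝ) :
    G.horizontalCrossed 0 0 y = (G.sinks.filter fun s => s ≤ y).card := by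
  unfold horizontalCrossed
  have h1 : (segments G.outcome (startingPoints G.nuc G.sinks) G.sources).countP
      (fun h => decide (0 < h.1.2 ∧ h.1.2 ≤ y ∧ h.1.1 ≤ 0 ∧ ∀ e ∈ h.2, 0 < e)) =
      (segments G.outcome (startingPoints G.nuc G.sinks) G.sources).countP
      (fun h => decide (0 < h.1.2 ∧ h.1.2 ≤ y ∧ h.1.1 ≤ 0)) := by
    refine List.countP_congr fun g hg => ?_
    have h0 : 0 ≤ g.1.1 := h.generic.2.1 _ (fst_mem_of_mem_segments hg)
    have he := endpoint_pos_of_mem_segments hg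
    simp only [decide_eq_true_eq]
    exact ⟨fun h => ⟨h.1, h.2.1, h.2.2.1⟩,
      fun h => ⟨h.1, h.2.1, h.2.2, fun e hm => h0.trans_lt (he e hm)⟩⟩
  rw [h1, countP_segments_fst (fun p => decide (0 < p.2 ∧ p.2 ≤ y ∧ p.1 ≤ 0)),
    countP_startingPoints]
  rw [← Finset.card_image_of_injective (G.sinks.filter fun s => s ≤ y)
    (Prod.mk_right_injective (0 : ℝ))]
  congr 1
  ext ⟨z, s⟩
  simp only [Finset.mem_filter, mem_startSet, Finset.mem_image, Prod.mk.injEq, decide_eq_true_eq,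
    exists_eq_right_right]
  constructor
  · rintro ⟨hp | hp, h1, h2, h3⟩
    · exact absurd h3 (h.nuc_pos _ hp).not_ge
    · exact ⟨⟨hp.2, h2⟩, hp.1.symm⟩
  · rintro ⟨⟨h1, h2⟩, rfl⟩
    exact ⟨Or.inr ⟨rfl, h1⟩, h.sinks_pos _ h1, h2, le_rfl⟩

/-! ### The coupled pictures -/

/-- The horizontal lines of the picture with sinks `ξ'`, flagged according to whether they are also
present in the picture with sinks `ξ`. -/
noncomputable def flaggedLines (nuc : Finset (ℝ × ℝ)) (ξ ξ' : Finset ℝ) : List (ℝ × Bool) :=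
  flagged (fun p => decide (p ∈ startSet nuc ξ)) (startingPoints nuc ξ')

/-- The picture with fewer sources and more sinks, built from the nucleations and the array `d`. -/
noncomputable def subPicture (η₀ ζ₀ ξ ξ' : Finset ℝ) (nuc : Finset (ℝ × ℝ)) (d : ℕ → ℕ → Bool) :
    Picture := ⟨η₀, ξ', nuc, subOutcome d (flaggedLines nuc ξ ξ') η₀ ζ₀⟩

/-- The picture with more sources and fewer sinks, built from the nucleations and the array `d`. -/
noncomputable def superPicture (ζ₀ ξ ξ' : Finset ℝ) (nuc : Finset (ℝ × ℝ)) (d : ℕ → ℕ → Bool) :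
    Picture := ⟨ζ₀, ξ, nuc, superOutcome d (flaggedLines nuc ξ ξ')⟩

/-- At every height the particles of the smaller picture are particles of the larger one, and the
number of unmatched particles is at most the number of additional sources and sinks so far. -/
lemma particles_subPicture {η₀ ζ₀ ξ ξ' : Finset ℝ} (hη : η₀ ⊆ ζ₀) (hξ : ξ ⊆ ξ')
    (nuc : Finset (ℝ × ℝ)) (d : ℕ → ℕ → Bool) (τ : ℝ) :
    (subPicture η₀ ζ₀ ξ ξ' nuc d).particles τ ⊆ (superPicture ζ₀ ξ ξ' nuc d).particles τ ∧
      ((superPicture ζ₀ ξ ξ' nuc d).particles τ \ (subPicture η₀ ζ₀ ξ ξ' nuc d).particles τ).card ≤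
        (ζ₀ \ η₀).card + ((ξ' \ ξ).filter fun s => s ≤ τ).card := by
  have hnew : ∀ p ∈ startingPoints nuc ξ', p ∉ startSet nuc ξ → p.1 = 0 ∧ p.2 ∈ ξ' \ ξ := by
    intro p hp hq
    rw [mem_startingPoints, mem_startSet] at hp
    rw [mem_startSet] at hq
    rw [Finset.mem_sdiff]
    tauto
  have key := run_subOutcome_subset (fun p => decide (p ∈ startSet nuc ξ)) (startingPoints nuc ξ')
    ((startingPoints nuc ξ').filter fun p => decide (p.2 ≤ τ))
    (filter_le_prefix (pairwise_startingPoints _ _) τ)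
    (fun p hp hq => by simp [(hnew p hp (by simpa using hq)).1]) d hη
  rw [List.filter_comm, filter_startingPoints hξ] at key
  refine ⟨key.1, key.2.trans (Nat.add_le_add_left ?_ _)⟩
  rw [List.countP_filter, countP_startingPoints]
  refine Finset.card_le_card_of_injOn Prod.snd (fun p hp => ?_) fun p hp p' hp' h => ?_
  · simp only [Finset.coe_filter, Set.mem_ofPred_eq, Bool.and_eq_true, Bool.not_eq_true',
      decide_eq_false_iff_not, decide_eq_true_eq] at hp ⊢
    exact ⟨(hnew p (mem_startingPoints.2 hp.1) hp.2.1).2, hp.2.2⟩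
  · simp only [Finset.coe_filter, Set.mem_ofPred_eq, Bool.and_eq_true, Bool.not_eq_true',
      decide_eq_false_iff_not, decide_eq_true_eq] at hp hp'
    exact Prod.ext ((hnew p (mem_startingPoints.2 hp.1) hp.2.1).1.trans
      (hnew p' (mem_startingPoints.2 hp'.1) hp'.2.1).1.symm) h

lemma numLE_mono {X Y : Finset ℝ} (h : X ⊆ Y) (x : ℝ) : numLE x X ≤ numLE x Y :=
  Finset.card_le_card (Finset.filter_subset_filter _ h)

lemma numLE_le_add_card_sdiff (X Y : Finset ℝ) (x : ℝ) :
    numLE x Y ≤ numLE x X + (Y \ X).card := by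
  refine (Finset.card_le_card fun p hp => ?_).trans (Finset.card_union_le _ _)
  simp only [Finset.mem_union, Finset.mem_filter, Finset.mem_sdiff] at hp ⊢
  tauto

/-- With the same sinks, the picture with more sources has the larger height function. -/
lemma heightLE_subPicture {η₀ ζ₀ ξ : Finset ℝ} (hη : η₀ ⊆ ζ₀) (nuc : Finset (ℝ × ℝ))
    (d : ℕ → ℕ → Bool) (h₁ : (subPicture η₀ ζ₀ ξ ξ nuc d).IsGeneric)
    (h₂ : (superPicture ζ₀ ξ ξ nuc d).IsGeneric) (T₁ T₂ : ℝ) :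
    HeightLE T₁ T₂ (subPicture η₀ ζ₀ ξ ξ nuc d) (superPicture ζ₀ ξ ξ nuc d) := by
  refine ⟨_, _, h₁.isHeightFunction T₁ T₂, h₂.isHeightFunction T₁ T₂, fun x _ y _ => ?_⟩
  have := numLE_mono (particles_subPicture hη (subset_refl ξ) nuc d y).1 x
  simp only [Picture.height, h₁.horizontalCrossed_zero, h₂.horizontalCrossed_zero]
  simp only [subPicture, superPicture] at this ⊢
  omega

/-- With the same sources, the picture with more sinks has the larger height function. -/
lemma heightLE_superPicture {ζ₀ ξ ξ' : Finset ℝ} (hξ : ξ ⊆ ξ') (nuc : Finset (ℝ × ℝ))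
    (d : ℕ → ℕ → Bool) (h₁ : (subPicture ζ₀ ζ₀ ξ ξ' nuc d).IsGeneric)
    (h₂ : (superPicture ζ₀ ξ ξ' nuc d).IsGeneric) (T₁ T₂ : ℝ) :
    HeightLE T₁ T₂ (superPicture ζ₀ ξ ξ' nuc d) (subPicture ζ₀ ζ₀ ξ ξ' nuc d) := by
  refine ⟨_, _, h₂.isHeightFunction T₁ T₂, h₁.isHeightFunction T₁ T₂, fun x _ y _ => ?_⟩
  have h := (particles_subPicture (subset_refl ζ₀) hξ nuc d y).2
  have := numLE_le_add_card_sdiff ((subPicture ζ₀ ζ₀ ξ ξ' nuc d).particles y)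
    ((superPicture ζ₀ ξ ξ' nuc d).particles y) x
  have hs : (ξ'.filter fun s => s ≤ y).card =
      (ξ.filter fun s => s ≤ y).card + ((ξ' \ ξ).filter fun s => s ≤ y).card := by
    rw [← Finset.card_union_of_disjoint (Finset.disjoint_filter_filter Finset.disjoint_sdiff),
      ← Finset.filter_union, Finset.union_sdiff_of_subset hξ]
  simp only [Picture.height, h₁.horizontalCrossed_zero, h₂.horizontalCrossed_zero]
  simp only [subPicture, superPicture, sdiff_self, Finset.bot_eq_empty, Finset.card_empty]
    at this h ⊢
  omega

/-! ### Invariance of the outcomes under order isomorphisms -/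

lemma toTheRight_image {S : Set ℝ} {φ : ℝ → ℝ} (hφ : StrictMonoOn φ S) {z : ℝ} (hz : z ∈ S)
    {X : Finset ℝ} (hX : ↑X ⊆ S) :
    toTheRight (φ z) (X.image φ) = (toTheRight z X).map φ := by
  unfold toTheRight
  have hfilter : (X.image φ).filter (fun x => φ z < x) = (X.filter fun x => z < x).image φ := by
    rw [Finset.filter_image]
    congr 1
    exact Finset.filter_congr fun x hx => hφ.lt_iff_lt hz (hX hx)
  have hmono : StrictMonoOn φ (X.filter fun x => z < x : Finset ℝ) :=
    hφ.mono fun x hx => hX (Finset.mem_filter.1 hx).1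
  rw [hfilter]
  have hn : ((X.filter fun x => z < x).sort.map φ).Nodup :=
    (Finset.sort_nodup _ _).map_on fun x hx y hy h =>
      hmono.injOn ((Finset.mem_sort _).1 hx) ((Finset.mem_sort _).1 hy) h
  have hperm := (List.perm_ext_iff_of_nodup (Finset.sort_nodup ((X.filter fun x => z < x).image φ)
    (· ≤ ·)) hn).2 fun x => by simp
  refine hperm.eq_of_pairwise'
    (r := (· ≤ ·)) (Finset.pairwise_sort _ _) ?_
  refine List.pairwise_map.2 ((Finset.pairwise_sort _ (· ≤ ·)).imp_of_mem fun hx hy h => ?_)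
  exact hmono.monotoneOn ((Finset.mem_sort _).1 hx) ((Finset.mem_sort _).1 hy) h

lemma idxOf_map_of_injOn {φ : ℝ → ℝ} {l : List ℝ} {x : ℝ}
    (h : ∀ y ∈ l, φ y = φ x → y = x) : (l.map φ).idxOf (φ x) = l.idxOf x := by
  induction l with
  | nil => rfl
  | cons y l ih =>
    rw [List.map_cons, List.idxOf_cons, List.idxOf_cons, ih fun y hy => h y (by simp [hy])]
    have hyx : φ y = φ x ↔ y = x := ⟨h y (by simp), fun he => he ▸ rfl⟩
    have hb : (φ y == φ x) = (y == x) := by simp only [Bool.beq_eq_decide_eq, hyx]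
    rw [hb]

lemma annihilatedAt_map (φ : ℝ → ℝ) (c : ℕ → Bool) (l : List ℝ) :
    annihilatedAt c (l.map φ) = (annihilatedAt c l).map φ := by
  induction l generalizing c with
  | nil => rfl
  | cons x l ih =>
    simp only [List.map_cons, annihilatedAt, ih]
    split_ifs <;> rfl

lemma relabelledRow_image {S : Set ℝ} {φ : ℝ → ℝ} (hφ : StrictMonoOn φ S) (c : ℕ → Bool) {z : ℝ}
    (hz : z ∈ S) {X Y : Finset ℝ} (hX : ↑X ⊆ S) (hY : ↑Y ⊆ S) :
    relabelledRow c (φ z) (X.image φ) (Y.image φ) = relabelledRow c z X Y := by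
  funext j
  unfold relabelledRow relabel
  rw [toTheRight_image hφ hz hX, toTheRight_image hφ hz hY]
  simp only [List.length_map, List.getElem_map]
  split_ifs with h
  · rw [idxOf_map_of_injOn]
    intro y hy he
    exact hφ.injOn (hY (mem_toTheRight.1 hy).1) (hX (mem_toTheRight.1 (List.getElem_mem h)).1) he
  · rfl

lemma step_image {S : Set ℝ} {φ : ℝ → ℝ} (hφ : StrictMonoOn φ S) (c : ℕ → Bool) {z : ℝ}
    (hz : z ∈ S) {X : Finset ℝ} (hX : ↑X ⊆ S) (h0 : 0 < φ z ↔ 0 < z) :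
    step c (φ z) (X.image φ) = (step c z X).image φ := by
  have he : endpoint c (φ z) (X.image φ) = (endpoint c z X).map φ := by
    unfold endpoint
    rw [toTheRight_image hφ hz hX, annihilatedAt_map]
  have herase : eraseOption ((endpoint c z X).map φ) (X.image φ) =
      (eraseOption (endpoint c z X) X).image φ := by
    cases hx : endpoint c z X with
    | none => rfl
    | some x =>
      ext y
      simp only [eraseOption, Option.map_some, Option.elim, Finset.mem_erase, Finset.mem_image]
      constructor
      · rintro ⟨hyx, u, hu, rfl⟩
        exact ⟨u, ⟨fun h => hyx (h ▸ rfl), hu⟩, rfl⟩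
      · rintro ⟨u, ⟨hux, hu⟩, rfl⟩
        exact ⟨fun h => hux (hφ.injOn (hX hu) (hX (mem_of_endpoint_eq_some hx).1) h), u, hu, rfl⟩
  simp only [step_eq, he, herase, h0]
  split_ifs
  · rw [Finset.image_insert]
  · rfl

lemma step_subset {S : Set ℝ} (c : ℕ → Bool) {z : ℝ} (hz : z ∈ S) {X : Finset ℝ} (hX : ↑X ⊆ S) :
    ↑(step c z X) ⊆ S := by
  have := eraseOption_subset (endpoint c z X) X
  intro x hx
  rw [step_eq] at hx
  split_ifs at hx
  · rcases Finset.mem_insert.1 (Finset.mem_coe.1 hx) with rfl | hx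
    · exact hz
    · exact hX (this hx)
  · exact hX (this hx)

/-- The coupled outcomes depend on the abscissas through their order and their signs only. -/
lemma subOutcome_image {S : Set ℝ} {φ : ℝ → ℝ} (hφ : StrictMonoOn φ S)
    (h0 : ∀ z ∈ S, 0 < φ z ↔ 0 < z) (d : ℕ → ℕ → Bool) (l : List (ℝ × Bool))
    (hl : ∀ p ∈ l, p.1 ∈ S) {X Y : Finset ℝ} (hX : ↑X ⊆ S) (hY : ↑Y ⊆ S) :
    subOutcome d (l.map fun p => (φ p.1, p.2)) (X.image φ) (Y.image φ) = subOutcome d l X Y := by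
  induction l generalizing d X Y with
  | nil => rfl
  | cons p l ih =>
    have hp := hl p (by simp)
    have hl' : ∀ p ∈ l, p.1 ∈ S := fun p hp => hl p (by simp [hp])
    simp only [List.map_cons, subOutcome]
    rw [relabelledRow_image hφ _ hp hX hY, step_image hφ _ hp hX (h0 _ hp),
      step_image hφ _ hp hY (h0 _ hp), step_image hφ _ hp hX (h0 _ hp),
      ih _ hl' (step_subset _ hp hX) (step_subset _ hp hY), ih _ hl' (step_subset _ hp hX) hY]

lemma superOutcome_map_snd (d : ℕ → ℕ → Bool) {l l' : List (ℝ × Bool)}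
    (h : l.map Prod.snd = l'.map Prod.snd) : superOutcome d l = superOutcome d l' := by
  induction l generalizing d l' with
  | nil =>
    cases l' with
    | nil => rfl
    | cons _ _ => simp at h
  | cons p l ih =>
    cases l' with
    | nil => simp at h
    | cons p' l' =>
      simp only [List.map_cons, List.cons.injEq] at h
      simp only [superOutcome, h.1, ih _ h.2]

lemma startSet_image {φ ψ : ℝ → ℝ} (nuc : Finset (ℝ × ℝ)) {ξ : Finset ℝ} (h0 : φ 0 = 0)
    (hξ : ∀ s ∈ ξ, ψ s = s) :
    startSet (nuc.image (Prod.map φ ψ)) ξ = (startSet nuc ξ).image (Prod.map φ ψ) := by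
  unfold startSet
  rw [Finset.image_union, Finset.image_image (g := Prod.map φ ψ)]
  congr 1
  exact Finset.image_congr fun s hs => by simp [h0, hξ s hs]

/-- Moving the nucleations by strictly monotone maps of the abscissas and of the heights that fix
the boundary data keeps the order of the horizontal lines and their flags. -/
lemma flaggedLines_image {S S' : Set ℝ} {φ ψ : ℝ → ℝ} (hφ : StrictMonoOn φ S)
    (hψ : StrictMonoOn ψ S') (h0 : φ 0 = 0) {ξ ξ' : Finset ℝ} (hξ : ξ ⊆ ξ')
    (hξ' : ∀ s ∈ ξ', ψ s = s) {nuc : Finset (ℝ × ℝ)}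
    (hS : ∀ p ∈ startSet nuc ξ', p.1 ∈ S ∧ p.2 ∈ S') :
    flaggedLines (nuc.image (Prod.map φ ψ)) ξ ξ' =
      (flaggedLines nuc ξ ξ').map fun p => (φ p.1, p.2) := by
  have hinj : Set.InjOn (Prod.map φ ψ) (startSet nuc ξ') := fun p hp p' hp' h => by
    simp only [Prod.map, Prod.mk.injEq] at h
    exact Prod.ext (hφ.injOn (hS p hp).1 (hS p' hp').1 h.1) (hψ.injOn (hS p hp).2 (hS p' hp').2 h.2)
  have hsub : startSet nuc ξ ⊆ startSet nuc ξ' := fun p hp => by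
    rw [mem_startSet] at hp ⊢
    exact hp.imp_right fun h => ⟨h.1, hξ h.2⟩
  have hstart : startingPoints (nuc.image (Prod.map φ ψ)) ξ' =
      (startingPoints nuc ξ').map (Prod.map φ ψ) := by
    refine (eq_startingPoints_of_pairwise ?_ ?_ fun p => ?_).symm
    · refine List.pairwise_map.2
        ((pairwise_startingPoints nuc ξ').imp_of_mem fun {p p'} hp hp' h => ?_)
      rw [mem_startingPoints] at hp hp'
      rw [startLE_iff] at h ⊢
      rcases h with h | h
      · exact Or.inl (hψ (hS p hp).2 (hS p' hp').2 h)
      · exact Or.inr ⟨congrArg ψ h.1, hφ.monotoneOn (hS p hp).1 (hS p' hp').1 h.2⟩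
    · refine (nodup_startingPoints nuc ξ').map_on fun p hp p' hp' h => hinj ?_ ?_ h
      · exact mem_startingPoints.1 hp
      · exact mem_startingPoints.1 hp'
    · rw [startSet_image nuc h0 hξ', List.mem_map, Finset.mem_image]
      simp only [mem_startingPoints]
  unfold flaggedLines flagged
  rw [hstart, List.map_map, List.map_map]
  refine List.map_congr_left fun p hp => ?_
  rw [mem_startingPoints] at hp
  simp only [Function.comp, Prod.map_fst, Prod.mk.injEq, true_and]
  rw [startSet_image nuc h0 fun s hs => hξ' s (hξ hs)]
  refine decide_eq_decide.2 ⟨fun h => ?_, fun h => Finset.mem_image_of_mem _ h⟩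
  obtain ⟨p', hp', he⟩ := Finset.mem_image.1 h
  exact hinj (hsub hp') hp he ▸ hp'

/-! ### The order pattern of the nucleations -/

/-- The first `n` points of a sequence. -/
noncomputable def firstPoints (n : ℕ) (u : ℕ → ℝ × ℝ) : Finset (ℝ × ℝ) :=
  (Finset.range n).image u

/-- The first `n` terms of a sequence together with the points of a fixed finite set. -/
def withConstants (n : ℕ) (C : Finset ℝ) (u : ℕ → ℝ) : Fin n ⊕ C → ℝ :=
  Sum.elim (fun i => u i) fun c => c

/-- All comparisons between the first `n` terms of a sequence and the points of a finite set. -/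
noncomputable def orderPattern (n : ℕ) (C : Finset ℝ) (u : ℕ → ℝ) : Fin n ⊕ C → Fin n ⊕ C → Bool :=
  fun i j => decide (withConstants n C u i < withConstants n C u j)

lemma exists_strictMonoOn {ι : Type*} {a a' : ι → ℝ} (h : ∀ i j, a i < a j ↔ a' i < a' j) :
    ∃ φ : ℝ → ℝ, StrictMonoOn φ (Set.range a) ∧ ∀ i, φ (a i) = a' i := by
  have hf : Function.FactorsThrough a' a := fun i j hij =>
    le_antisymm (not_lt.1 fun hlt => ((h j i).2 hlt).ne' hij)
      (not_lt.1 fun hlt => ((h i j).2 hlt).ne hij)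
  refine ⟨Function.extend a a' 0, ?_, fun i => hf.extend_apply 0 i⟩
  rintro _ ⟨i, rfl⟩ _ ⟨j, rfl⟩ hij
  rw [hf.extend_apply, hf.extend_apply]
  exact (h i j).1 hij

lemma exists_strictMonoOn_of_orderPattern_eq {n : ℕ} {C : Finset ℝ} {u u' : ℕ → ℝ}
    (h : orderPattern n C u = orderPattern n C u') :
    ∃ (S : Set ℝ) (φ : ℝ → ℝ), StrictMonoOn φ S ∧ (∀ i < n, u i ∈ S ∧ φ (u i) = u' i) ∧
      ∀ c ∈ C, c ∈ S ∧ φ c = c := by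
  obtain ⟨φ, hφ, hφu⟩ := exists_strictMonoOn (a := withConstants n C u)
    (a' := withConstants n C u') fun i j => by
      have := congrFun (congrFun h i) j
      simpa [orderPattern] using this
  exact ⟨_, φ, hφ, fun i hi => ⟨⟨Sum.inl ⟨i, hi⟩, rfl⟩, hφu (Sum.inl ⟨i, hi⟩)⟩,
    fun c hc => ⟨⟨Sum.inr ⟨c, hc⟩, rfl⟩, hφu (Sum.inr ⟨c, hc⟩)⟩⟩

/-- The order pattern of the first `n` nucleations relative to the boundary data: the order of the
abscissas, of `0` and of the sources, and the order of the heights and of the sinks. It takes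
finitely many values, and the coupled outcomes are a function of it. -/
noncomputable def nucPattern (n : ℕ) (ζ₀ ξ' : Finset ℝ) (u : ℕ → ℝ × ℝ) :=
  (orderPattern n (insert 0 ζ₀) fun i => (u i).1, orderPattern n ξ' fun i => (u i).2)

lemma outcome_eq_of_nucPattern_eq {n : ℕ} {η₀ ζ₀ ξ ξ' : Finset ℝ} (hη : η₀ ⊆ ζ₀) (hξ : ξ ⊆ ξ')
    {u u' : ℕ → ℝ × ℝ} (h : nucPattern n ζ₀ ξ' u = nucPattern n ζ₀ ξ' u') (d : ℕ → ℕ → Bool) :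
    subOutcome d (flaggedLines (firstPoints n u) ξ ξ') η₀ ζ₀ =
        subOutcome d (flaggedLines (firstPoints n u') ξ ξ') η₀ ζ₀ ∧
      superOutcome d (flaggedLines (firstPoints n u) ξ ξ') =
        superOutcome d (flaggedLines (firstPoints n u') ξ ξ') := by
  obtain ⟨S, φ, hφ, hφu, hφC⟩ := exists_strictMonoOn_of_orderPattern_eq (congrArg Prod.fst h)
  obtain ⟨S', ψ, hψ, hψu, hψC⟩ := exists_strictMonoOn_of_orderPattern_eq (congrArg Prod.snd h)
  have h0 := hφC 0 (by simp)
  have hnuc : firstPoints n u' = (firstPoints n u).image (Prod.map φ ψ) := by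
    unfold firstPoints
    rw [Finset.image_image]
    refine Finset.image_congr fun i hi => ?_
    have hi : i < n := by simpa using hi
    exact Prod.ext (hφu i hi).2.symm (hψu i hi).2.symm
  have hS : ∀ p ∈ startSet (firstPoints n u) ξ', p.1 ∈ S ∧ p.2 ∈ S' := by
    intro p hp
    rcases mem_startSet.1 hp with hp | hp
    · obtain ⟨i, hi, rfl⟩ := Finset.mem_image.1 hp
      rw [Finset.mem_range] at hi
      exact ⟨(hφu i hi).1, (hψu i hi).1⟩
    · exact ⟨hp.1 ▸ h0.1, (hψC _ hp.2).1⟩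
  have hfix : ∀ Z ⊆ ζ₀, ↑Z ⊆ S ∧ Z.image φ = Z := fun Z hZ =>
    ⟨fun z hz => (hφC z (Finset.mem_insert_of_mem (hZ hz))).1, by
      rw [Finset.image_congr fun z hz => (hφC z (Finset.mem_insert_of_mem (hZ hz))).2]
      exact Finset.image_id'⟩
  rw [hnuc, flaggedLines_image hφ hψ h0.2 hξ (fun s hs => (hψC s hs).2) hS]
  constructor
  · have := subOutcome_image hφ (fun z hz => by
        have := hφ.lt_iff_lt h0.1 hz
        rwa [h0.2] at this) d (flaggedLines (firstPoints n u) ξ ξ') (fun p hp => by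
        obtain ⟨p', hp', rfl⟩ := List.mem_map.1 hp
        exact (hS p' (mem_startingPoints.1 hp')).1) (hfix η₀ hη).1 (hfix ζ₀ subset_rfl).1
    rw [(hfix η₀ hη).2, (hfix ζ₀ subset_rfl).2] at this
    exact this.symm
  · exact superOutcome_map_snd _ (by simp)

/-- A family of measurable maps that depends on its parameter only through a countably valued
measurable function is jointly measurable. -/
lemma measurable_uncurry_of_countable {α β γ δ : Type*} [MeasurableSpace α] [MeasurableSpace β]
    [MeasurableSpace γ] [MeasurableSpace δ] [Countable γ] [MeasurableSingletonClass γ] {π : α → γ}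
    (hπ : Measurable π) {F : α → β → δ} (hF : ∀ a, Measurable (F a))
    (h : ∀ a a', π a = π a' → F a = F a') : Measurable (Function.uncurry F) := by
  intro s hs
  have : Function.uncurry F ⁻¹' s =
      ⋃ c : γ, ⋃ h : ∃ a, π a = c, (π ⁻¹' {c}) ×ˢ (F h.choose ⁻¹' s) := by
    ext ⟨a, b⟩
    simp only [Set.mem_preimage, Function.uncurry, Set.mem_iUnion, Set.mem_prod,
      Set.mem_singleton_iff]
    constructor
    · intro hab
      have hex : ∃ a', π a' = π a := ⟨a, rfl⟩
      exact ⟨π a, hex, rfl, by rwa [h _ _ hex.choose_spec]⟩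
    · rintro ⟨c, hc, rfl, hb⟩
      rwa [h _ _ hc.choose_spec] at hb
  rw [this]
  exact .iUnion fun c => .iUnion fun hc =>
    (hπ (measurableSet_singleton c)).prod (hF _ hs)

lemma measurable_orderPattern (n : ℕ) (C : Finset ℝ) : Measurable (orderPattern n C) := by
  have hw : ∀ i, Measurable fun u : ℕ → ℝ => withConstants n C u i := by
    rintro (i | c)
    · exact measurable_pi_apply _
    · exact measurable_const
  refine measurable_pi_iff.2 fun i => measurable_pi_iff.2 fun j => measurable_to_bool ?_
  have : (fun u : ℕ → ℝ => orderPattern n C u i j) ⁻¹' {true} =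
      {u | withConstants n C u i < withConstants n C u j} := by
    ext u
    simp [orderPattern]
  rw [this]
  exact measurableSet_lt (hw i) (hw j)

lemma measurable_nucPattern (n : ℕ) (ζ₀ ξ' : Finset ℝ) : Measurable (nucPattern n ζ₀ ξ') := by
  refine ((measurable_orderPattern _ _).comp ?_).prodMk ((measurable_orderPattern _ _).comp ?_)
  · fun_prop
  · fun_prop

/-! ### The coupled outcomes are independent -/

section Rows

variable {α : Type*} [MeasurableSpace α]

lemma measurable_consRow : Measurable fun p : α × (ℕ → α) => consRow p.1 p.2 := by
  refine measurable_pi_iff.2 fun k => ?_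
  cases k with
  | zero => exact measurable_fst
  | succ k => exact (measurable_pi_apply k).comp measurable_snd

/-- An independent sequence is obtained by prepending an independent term to such a sequence. -/
lemma measurePreserving_consRow (ν : Measure α) [IsProbabilityMeasure ν] :
    MeasurePreserving (fun p : α × (ℕ → α) => consRow p.1 p.2)
      (ν.prod (Measure.infinitePi fun _ : ℕ => ν)) (Measure.infinitePi fun _ : ℕ => ν) := by
  refine ⟨measurable_consRow, Measure.eq_infinitePi _ fun s t ht => ?_⟩
  have hs : MeasurableSet ((s : Set ℕ).pi t) := .pi s.countable_toSet fun i _ => ht i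
  rw [Measure.map_apply measurable_consRow hs]
  -- the event only concerns finitely many rows, so that it may be prolonged by trivial constraints
  set t' : ℕ → Set α := fun i => if i ∈ s then t i else Set.univ with ht'
  obtain ⟨m, hm⟩ : ∃ m, s ⊆ Finset.range (m + 1) :=
    ⟨s.sup id, fun i hi => Finset.mem_range_succ_iff.2 (Finset.le_sup (f := id) hi)⟩
  have hmeas : ∀ i, MeasurableSet (t' i) := fun i => by
    simp only [ht']
    split_ifs
    exacts [ht i, .univ]
  have hpre : (fun p : α × (ℕ → α) => consRow p.1 p.2) ⁻¹' (s : Set ℕ).pi t =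
      t' 0 ×ˢ ((Finset.range m : Set ℕ).pi fun k => t' (k + 1)) := by
    ext ⟨r, f⟩
    simp only [Set.mem_preimage, Set.mem_pi, Set.mem_prod, ht']
    constructor
    · intro h
      refine ⟨?_, fun k _ => ?_⟩
      · split_ifs with h0
        exacts [h 0 h0, trivial]
      · split_ifs with h0
        exacts [h (k + 1) h0, trivial]
    · rintro ⟨h0, hk⟩ i hi
      have him := Finset.mem_range.1 (hm hi)
      cases i with
      | zero => simpa [Finset.mem_coe.1 hi] using h0
      | succ k =>
        have := hk k (by simpa using him)
        simpa [Finset.mem_coe.1 hi] using this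
  have hprod : ∏ i ∈ s, ν (t i) = ∏ i ∈ Finset.range (m + 1), ν (t' i) := by
    rw [← Finset.prod_subset hm fun i _ hi => by simp [ht', hi]]
    exact Finset.prod_congr rfl fun i hi => by simp [ht', hi]
  rw [hpre, Measure.prod_prod, Measure.infinitePi_pi _ fun i _ => hmeas _, hprod,
    Finset.prod_range_succ', mul_comm]

lemma measurePreserving_uncons (ν : Measure α) [IsProbabilityMeasure ν] :
    MeasurePreserving (fun d : ℕ → α => (d 0, fun k => d (k + 1)))
      (Measure.infinitePi fun _ : ℕ => ν) (ν.prod (Measure.infinitePi fun _ : ℕ => ν)) := by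
  have hm : Measurable (fun d : ℕ → α => (d 0, fun k => d (k + 1))) := by fun_prop
  refine ⟨hm, ?_⟩
  conv_lhs => rw [← (measurePreserving_consRow ν).map_eq]
  rw [Measure.map_map hm measurable_consRow]
  exact Measure.map_id

end Rows

lemma annihilatedAt_congr {c c' : ℕ → Bool} {l : List ℝ} (h : ∀ j < l.length, c j = c' j) :
    annihilatedAt c l = annihilatedAt c' l := by
  induction l generalizing c c' with
  | nil => rfl
  | cons x l ih =>
    simp only [annihilatedAt, h 0 (by simp)]
    rw [ih fun j hj => h (j + 1) (by simpa using hj)]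

lemma step_congr {c c' : ℕ → Bool} {z : ℝ} {X : Finset ℝ}
    (h : ∀ j < (toTheRight z X).length, c j = c' j) : step c z X = step c' z X := by
  rw [step_eq, step_eq, endpoint, endpoint, annihilatedAt_congr h]

/-- The first `m` outcomes of a row. -/
def initialOutcomes (m : ℕ) (c : ℕ → Bool) (j : Fin m) : Bool := c j

lemma measurable_initialOutcomes (m : ℕ) : Measurable (initialOutcomes m) :=
  measurable_pi_iff.2 fun _ => measurable_pi_apply _

lemma step_eq_of_initialOutcomes_eq {c c' : ℕ → Bool} {z : ℝ} {X : Finset ℝ}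
    (h : initialOutcomes (toTheRight z X).length c = initialOutcomes (toTheRight z X).length c') :
    step c z X = step c' z X :=
  step_congr fun j hj => congrFun h ⟨j, hj⟩

/-- The relabelled row also uses only as many outcomes as there are lines in the larger picture. -/
lemma step_relabelledRow_eq_of_initialOutcomes_eq {c c' : ℕ → Bool} {z : ℝ} {X Y : Finset ℝ}
    (hXY : X ⊆ Y)
    (h : initialOutcomes (toTheRight z Y).length c = initialOutcomes (toTheRight z Y).length c') :
    step (relabelledRow c z X Y) z X = step (relabelledRow c' z X Y) z X := by
  refine step_congr fun j hj => ?_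
  have : relabel (toTheRight z X) (toTheRight z Y) j < (toTheRight z Y).length := by
    rw [relabel, dif_pos hj]
    exact List.idxOf_lt_length_iff.2 (toTheRight_subset hXY (List.getElem_mem hj))
  exact congrFun h ⟨_, this⟩

lemma measurePreserving_relabelledRow (β : Measure Bool) [IsProbabilityMeasure β] {X Y : Finset ℝ}
    (hXY : X ⊆ Y) (z : ℝ) :
    MeasurePreserving (fun c => relabelledRow c z X Y) (Measure.infinitePi fun _ : ℕ => β)
      (Measure.infinitePi fun _ : ℕ => β) where
  measurable := measurable_pi_iff.2 fun _ => measurable_pi_apply _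
  map_eq := Measure.map_infinitePi_infinitePi_of_inj (P := fun _ : ℕ => β)
    (relabel_injective (nodup_toTheRight z X) (toTheRight_subset hXY))

/-- The law of an array of independent outcomes with law `β`. -/
noncomputable def arrayLaw (β : Measure Bool) [IsProbabilityMeasure β] : Measure (ℕ → ℕ → Bool) :=
  Measure.infinitePi fun _ : ℕ => Measure.infinitePi fun _ : ℕ => β

instance (β : Measure Bool) [IsProbabilityMeasure β] : IsProbabilityMeasure (arrayLaw β) := by
  unfold arrayLaw
  infer_instance

lemma measurePreserving_superOutcome (β : Measure Bool) [IsProbabilityMeasure β]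
    (l : List (ℝ × Bool)) :
    MeasurePreserving (fun d => superOutcome d l) (arrayLaw β) (arrayLaw β) := by
  induction l with
  | nil => exact MeasurePreserving.id _
  | cons p l ih =>
    cases hp : p.2 with
    | true =>
      simp only [superOutcome, hp, if_true]
      exact ((measurePreserving_consRow _).comp ((MeasurePreserving.id _).prod ih)).comp
        (measurePreserving_uncons _)
    | false =>
      simp only [superOutcome, hp, Bool.false_eq_true, if_false]
      exact (ih.comp measurePreserving_snd).comp (measurePreserving_uncons _)

/-- The row of outcomes used for a horizontal line is a fresh row of `d`, re-indexed by an injection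
that depends on earlier rows only. Hence the array keeps its law. -/
lemma measurePreserving_subOutcome (β : Measure Bool) [IsProbabilityMeasure β]
    (l : List (ℝ × Bool)) {X Y : Finset ℝ} (hXY : X ⊆ Y) (hl : ∀ p ∈ l, p.2 = false → ¬ 0 < p.1) :
    MeasurePreserving (fun d => subOutcome d l X Y) (arrayLaw β) (arrayLaw β) := by
  induction l generalizing X Y with
  | nil => exact MeasurePreserving.id _
  | cons p l ih =>
    have hl' : ∀ p ∈ l, p.2 = false → ¬ 0 < p.1 := fun p hp => hl p (by simp [hp])
    cases hp : p.2 with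
    | true =>
      simp only [subOutcome, hp, if_true]
      refine ((measurePreserving_consRow _).comp
        ((measurePreserving_relabelledRow β hXY p.1).skew_product
        (g := fun r f => subOutcome f l (step (relabelledRow r p.1 X Y) p.1 X) (step r p.1 Y))
        ?_ ?_)).comp (measurePreserving_uncons _)
      · refine measurable_uncurry_of_countable
          (measurable_initialOutcomes (toTheRight p.1 Y).length)
          (fun r => (ih (step_common hXY r p.1).1 hl').measurable) fun r r' h => ?_
        rw [step_eq_of_initialOutcomes_eq h, step_relabelledRow_eq_of_initialOutcomes_eq hXY h]
      · exact ae_of_all _ fun r => (ih (step_common hXY r p.1).1 hl').map_eq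
    | false =>
      simp only [subOutcome, hp, Bool.false_eq_true, if_false]
      refine ((measurePreserving_consRow _).comp
        ((MeasurePreserving.id _).skew_product
        (g := fun r f => subOutcome f l (step r p.1 X) Y)
        ?_ ?_)).comp (measurePreserving_uncons _)
      · refine measurable_uncurry_of_countable
          (measurable_initialOutcomes (toTheRight p.1 X).length)
          (fun r => (ih (step_new hXY r (hl p (by simp) hp)).1 hl').measurable) fun r r' h => ?_
        rw [step_eq_of_initialOutcomes_eq h]
      · exact ae_of_all _ fun r => (ih (step_new hXY r (hl p (by simp) hp)).1 hl').map_eq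

/-! ### Construction of the Poisson process -/

section Poisson

open scoped NNReal

/-- A Poisson number of independent points with law `μ`: the number and the sequence of points. -/
noncomputable def pointsLaw (r : ℝ≥0) (μ : Measure (ℝ × ℝ)) [IsProbabilityMeasure μ] :
    Measure (ℕ × (ℕ → ℝ × ℝ)) :=
  (poissonMeasure r).prod (Measure.infinitePi fun _ : ℕ => μ)

instance (r : ℝ≥0) (μ : Measure (ℝ × ℝ)) [IsProbabilityMeasure μ] :
    IsProbabilityMeasure (pointsLaw r μ) := by
  unfold pointsLaw
  infer_instance

/-- The number of points in `B`, counted with multiplicity. Unlike `count` it is a sum over the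
points; the two agree when the points are distinct. -/
noncomputable def multCount (B : Set (ℝ × ℝ)) (ω : ℕ × (ℕ → ℝ × ℝ)) : ℕ :=
  ∑ i ∈ Finset.range ω.1, B.indicator 1 (ω.2 i)

variable {r : ℝ≥0} {μ : Measure (ℝ × ℝ)} [IsProbabilityMeasure μ]

lemma measurable_multCount {B : Set (ℝ × ℝ)} (hB : MeasurableSet B) : Measurable (multCount B) := by
  refine measurable_from_prod_countable_right fun n => ?_
  have h1 : Measurable (B.indicator (1 : ℝ × ℝ → ℕ)) := measurable_one.indicator hB
  simp only [multCount]
  exact Finset.measurable_fun_sum _ fun i _ => h1.comp (measurable_pi_apply i)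

/-- The generating functional of the points: the factor `∫ f` of each point is summed against the
Poisson weights. -/
lemma integral_prod_points {f : ℝ × ℝ → ℂ} (hf : Measurable f) (hb : ∀ p, ‖f p‖ ≤ 1) :
    ∫ ω, ∏ i ∈ Finset.range ω.1, f (ω.2 i) ∂pointsLaw r μ =
      Complex.exp (r * (∫ p, f p ∂μ - 1)) := by
  have hmeas : Measurable fun ω : ℕ × (ℕ → ℝ × ℝ) => ∏ i ∈ Finset.range ω.1, f (ω.2 i) :=
    measurable_from_prod_countable_right fun n =>
      Finset.measurable_fun_prod (Finset.range n) (f := fun i (u : ℕ → ℝ × ℝ) => f (u i))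
        fun i _ => hf.comp (measurable_pi_apply i)
  have hint : Integrable (fun ω : ℕ × (ℕ → ℝ × ℝ) => ∏ i ∈ Finset.range ω.1, f (ω.2 i))
      (pointsLaw r μ) := by
    refine Integrable.of_bound hmeas.aestronglyMeasurable 1 (ae_of_all _ fun ω => ?_)
    rw [norm_prod]
    exact Finset.prod_le_one (fun _ _ => norm_nonneg _) fun _ _ => hb _
  have hinner : ∀ n : ℕ, ∫ u, ∏ i ∈ Finset.range n, f (u i) ∂(Measure.infinitePi fun _ : ℕ => μ) =
      (∫ p, f p ∂μ) ^ n := by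
    intro n
    have h := integral_restrict_infinitePi (μ := fun _ : ℕ => μ) (s := Finset.range n)
      (f := fun y => ∏ i : Finset.range n, f (y i)) (by
        refine Measurable.aestronglyMeasurable ?_
        exact Finset.measurable_fun_prod _ fun i _ => hf.comp (measurable_pi_apply i))
    rw [integral_fintype_prod_eq_prod (fun _ => f)] at h
    simp only [Finset.prod_const, Finset.card_univ, Fintype.card_coe, Finset.card_range] at h
    rw [← h]
    refine integral_congr_ae (ae_of_all _ fun u => ?_)
    simp only [Finset.restrict]
    exact (Finset.prod_coe_sort (Finset.range n) fun i => f (u i)).symm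
  rw [pointsLaw, integral_prod _ hint]
  simp only [hinner]
  rw [integral_poissonMeasure]
  set a := ∫ p, f p ∂μ
  have : ∀ n : ℕ, (Real.exp (-r) * r ^ n / n.factorial : ℝ) • a ^ n =
      Real.exp (-r) * ((r * a) ^ n / n.factorial) := by
    intro n
    rw [Complex.real_smul]
    push_cast
    ring
  simp only [this]
  rw [tsum_mul_left, (NormedSpace.expSeries_div_hasSum_exp ((r : ℂ) * a)).tsum_eq,
    ← Complex.exp_eq_exp_ℂ, Complex.ofReal_exp, ← Complex.exp_add]
  congr 1
  push_cast
  ring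

/-- The joint characteristic function of the numbers of points in disjoint sets. -/
lemma integral_exp_multCount {ι : Type*} [Fintype ι] {B : ι → Set (ℝ × ℝ)}
    (hB : ∀ i, MeasurableSet (B i)) (hd : Pairwise fun i j => Disjoint (B i) (B j)) (t : ι → ℝ) :
    ∫ ω, Complex.exp ((∑ i, t i * (multCount (B i) ω : ℝ) : ℝ) * Complex.I) ∂pointsLaw r μ =
      ∏ i, Complex.exp ((r * (μ (B i)).toNNReal : ℝ≥0) * (Complex.exp (t i * Complex.I) - 1)) := by
  -- the contribution of a single point
  set f : ℝ × ℝ → ℂ := fun p => Complex.exp ((∑ i, t i * (B i).indicator 1 p : ℝ) * Complex.I)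
    with hf
  have hfm : Measurable f := by
    have : Measurable fun p => ∑ i, t i * (B i).indicator (1 : ℝ × ℝ → ℝ) p :=
      Finset.measurable_fun_sum _ fun i _ => (measurable_one.indicator (hB i)).const_mul _
    fun_prop
  have hfb : ∀ p, ‖f p‖ ≤ 1 := fun p => (Complex.norm_exp_ofReal_mul_I _).le
  have h1 : ∀ ω : ℕ × (ℕ → ℝ × ℝ),
      Complex.exp ((∑ i, t i * (multCount (B i) ω : ℝ) : ℝ) * Complex.I) =
      ∏ m ∈ Finset.range ω.1, f (ω.2 m) := by
    intro ω
    rw [hf, ← Complex.exp_sum, ← Finset.sum_mul, ← Complex.ofReal_sum, Finset.sum_comm]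
    congr 3
    refine Finset.sum_congr rfl fun i _ => ?_
    rw [multCount, Nat.cast_sum, Finset.mul_sum]
    refine Finset.sum_congr rfl fun m _ => ?_
    by_cases h : ω.2 m ∈ B i <;> simp [h]
  -- by disjointness a point lies in at most one of the sets
  have h2 : ∀ p, f p = 1 + ∑ i, (B i).indicator (fun _ => Complex.exp (t i * Complex.I) - 1) p := by
    intro p
    by_cases hp : ∃ i, p ∈ B i
    · obtain ⟨i, hi⟩ := hp
      have hj : ∀ j, j ≠ i → p ∉ B j := fun j hj hpj =>
        Set.disjoint_left.1 (hd hj) hpj hi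
      simp only [hf]
      rw [Finset.sum_eq_single i (fun j _ h => by simp [hj j h]) (by simp),
        Finset.sum_eq_single i (fun j _ h => by simp [hj j h]) (by simp)]
      simp [hi]
    · push Not at hp
      simp [hf, hp]
  have h3 : ∫ p, f p ∂μ - 1 = ∑ i, (μ (B i)).toNNReal * (Complex.exp (t i * Complex.I) - 1) := by
    have hi : ∀ i, Integrable ((B i).indicator fun _ => Complex.exp (t i * Complex.I) - 1) μ :=
      fun i => (integrable_const _).indicator (hB i)
    simp only [h2]
    rw [integral_add (integrable_const _) (integrable_finsetSum _ fun i _ => hi i),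
      integral_finsetSum _ fun i _ => hi i]
    simp only [integral_const, probReal_univ, one_smul, add_sub_cancel_left]
    refine Finset.sum_congr rfl fun i _ => ?_
    rw [integral_indicator_const _ (hB i), Complex.real_smul]
    rfl
  simp only [h1]
  rw [integral_prod_points hfm hfb, h3, ← Complex.exp_sum]
  congr 1
  rw [Finset.mul_sum]
  refine Finset.sum_congr rfl fun i _ => ?_
  push_cast
  ring

lemma charFun_multCount {B : Set (ℝ × ℝ)} (hB : MeasurableSet B) (t : ℝ) :
    charFun ((pointsLaw r μ).map fun ω => (multCount B ω : ℝ)) t =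
      Complex.exp ((r * (μ B).toNNReal : ℝ≥0) * (Complex.exp (t * Complex.I) - 1)) := by
  have h := integral_exp_multCount (r := r) (μ := μ) (B := fun _ : Unit => B) (fun _ => hB)
    (fun i j hij => absurd (Subsingleton.elim i j) hij) fun _ => t
  simp only [Finset.univ_unique, Finset.sum_singleton, Finset.prod_singleton] at h
  rw [charFun_apply_real, integral_map, ← h]
  · simp
  · exact (measurable_from_top.comp (measurable_multCount hB)).aemeasurable
  · fun_prop

lemma map_multCount {B : Set (ℝ × ℝ)} (hB : MeasurableSet B) :
    (pointsLaw r μ).map (multCount B) = poissonMeasure (r * (μ B).toNNReal) := by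
  apply (MeasurableEmbedding.natCast (α := ℝ)).map_injective
  apply Measure.ext_of_charFun
  ext t
  rw [charFun_map_cast_poissonMeasure, ← charFun_multCount hB,
    Measure.map_map measurable_from_top (measurable_multCount hB)]
  rfl

lemma iIndepFun_multCount {ι : Type*} [Fintype ι] {B : ι → Set (ℝ × ℝ)}
    (hB : ∀ i, MeasurableSet (B i)) (hd : Pairwise fun i j => Disjoint (B i) (B j)) :
    iIndepFun (fun i => multCount (B i)) (pointsLaw r μ) := by
  have hm : ∀ i, Measurable fun ω => (multCount (B i) ω : ℝ) := fun i =>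
    measurable_from_top.comp (measurable_multCount (hB i))
  have h : iIndepFun (fun i ω => (multCount (B i) ω : ℝ)) (pointsLaw r μ) := by
    rw [iIndepFun_iff_charFun_pi fun i => (hm i).aemeasurable]
    intro t
    simp only [charFun_multCount (hB _)]
    rw [← integral_exp_multCount hB hd, charFun_apply, integral_map]
    · refine integral_congr_ae (ae_of_all _ fun ω => ?_)
      simp [PiLp.inner_apply, mul_comm]
    · exact Measurable.aemeasurable (by fun_prop)
    · fun_prop
  have := h.comp (fun _ x => ⌊x⌋₊) fun _ => Nat.measurable_floor
  simpa [Function.comp_def] using this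

/-- A further point is counted unless it coincides with an earlier one. -/
lemma count_firstPoints_succ (n : ℕ) (u : ℕ → ℝ × ℝ) (B : Set (ℝ × ℝ)) :
    count (firstPoints (n + 1) u) B =
      count (firstPoints n u) B + if u n ∈ B ∧ ∀ j < n, u j ≠ u n then 1 else 0 := by
  unfold count firstPoints
  rw [Finset.range_add_one, Finset.image_insert, Finset.filter_insert]
  by_cases hB : u n ∈ B
  · by_cases hj : ∀ j < n, u j ≠ u n
    · rw [if_pos hB, if_pos ⟨hB, hj⟩, Finset.card_insert_of_notMem]
      simp only [Finset.mem_filter, Finset.mem_image, Finset.mem_range, not_and]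
      rintro ⟨j, hjn, he⟩
      exact absurd he (hj j hjn)
    · rw [if_pos hB, if_neg fun h => hj h.2, Finset.insert_eq_of_mem, add_zero]
      push Not at hj
      obtain ⟨j, hjn, he⟩ := hj
      exact Finset.mem_filter.2 ⟨Finset.mem_image.2 ⟨j, by simpa using hjn, he⟩, hB⟩
  · rw [if_neg hB, if_neg fun h => hB h.1, add_zero]

lemma measurable_count_firstPoints {B : Set (ℝ × ℝ)} (hB : MeasurableSet B) :
    Measurable fun ω : ℕ × (ℕ → ℝ × ℝ) => count (firstPoints ω.1 ω.2) B := by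
  refine measurable_from_prod_countable_right fun n => ?_
  induction n with
  | zero => simp [firstPoints, count]
  | succ n ih =>
    simp only [count_firstPoints_succ] at ih ⊢
    refine ih.add (Measurable.ite ?_ measurable_const measurable_const)
    have hu : ∀ i, Measurable fun u : ℕ → ℝ × ℝ => u i := fun i => measurable_pi_apply i
    have : {u : ℕ → ℝ × ℝ | u n ∈ B ∧ ∀ j < n, u j ≠ u n} =
        (fun u => u n) ⁻¹' B ∩ ⋂ j, ⋂ (_ : j < n), {u | u j = u n}ᶜ := by
      ext u
      simp
    rw [this]
    exact (hu n hB).inter (.iInter fun j => .iInter fun _ =>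
      (measurableSet_eq_fun (hu j) (hu n)).compl)

lemma count_firstPoints_eq_multCount {n : ℕ} {u : ℕ → ℝ × ℝ} (hu : Function.Injective u)
    (B : Set (ℝ × ℝ)) : count (firstPoints n u) B = multCount B (n, u) := by
  induction n with
  | zero => simp [firstPoints, count, multCount]
  | succ n ih =>
    rw [count_firstPoints_succ, ih]
    simp only [multCount, Finset.sum_range_succ]
    congr 1
    have : ∀ j < n, u j ≠ u n := fun j hj he => hj.ne (hu he)
    by_cases hB : u n ∈ B
    · rw [if_pos ⟨hB, this⟩]
      simp [hB]
    · rw [if_neg fun h => hB h.1]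
      simp [hB]

/-- If `μ` does not charge vertical lines, then the points have almost surely distinct abscissas. -/
lemma ae_fst_injective (hμ : ∀ a, μ {p | p.1 = a} = 0) :
    ∀ᵐ u ∂(Measure.infinitePi fun _ : ℕ => μ), Function.Injective fun i => (u i).1 := by
  have h : ∀ i j, i ≠ j → ∀ᵐ u ∂(Measure.infinitePi fun _ : ℕ => μ), (u i).1 ≠ (u j).1 := by
    intro i j hij
    have hmeas : MeasurableSet {q : (ℝ × ℝ) × (ℝ × ℝ) | q.1.1 ≠ q.2.1} :=
      (measurableSet_eq_fun (by fun_prop) (by fun_prop)).compl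
    have hprod : ∀ᵐ q ∂μ.prod μ, q.1.1 ≠ q.2.1 := by
      rw [Measure.ae_prod_iff_ae_ae hmeas]
      refine ae_of_all _ fun p => ?_
      rw [ae_iff]
      simpa [eq_comm] using hμ p.1
    rw [← Measure.infinitePi_map_eval_prod (P := fun _ : ℕ => μ) hij] at hprod
    exact ae_of_ae_map (f := fun u : ℕ → ℝ × ℝ => (u i, u j))
      (Measurable.aemeasurable (by fun_prop)) hprod
  have h' : ∀ᵐ u ∂(Measure.infinitePi fun _ : ℕ => μ), ∀ i j, i ≠ j → (u i).1 ≠ (u j).1 := by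
    rw [ae_all_iff]
    intro i
    rw [ae_all_iff]
    intro j
    by_cases hij : i = j
    · exact ae_of_all _ fun u h => absurd hij h
    · exact (h i j hij).mono fun u hu _ => hu
  filter_upwards [h'] with u hu i j hij
  by_contra hne
  exact hu i j hne hij

lemma ae_forall_points {Q : ℝ × ℝ → Prop} (hQ : ∀ᵐ p ∂μ, Q p) :
    ∀ᵐ u ∂(Measure.infinitePi fun _ : ℕ => μ), ∀ i, Q (u i) :=
  ae_all_iff.2 fun i => (measurePreserving_eval_infinitePi (fun _ : ℕ => μ)
    i).quasiMeasurePreserving.ae hQ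

end Poisson

/-! ### The coupled models -/

section Transfer

variable {Ω Ω' : Type*} [MeasurableSpace Ω] [MeasurableSpace Ω'] {P : Measure Ω} {P' : Measure Ω'}
  [IsProbabilityMeasure P] [IsProbabilityMeasure P'] {T : Ω → Ω'}

lemma iIndepFun_comp_measurePreserving (hT : MeasurePreserving T P P') {ι : Type*} {γ : ι → Type*}
    [∀ i, MeasurableSpace (γ i)] {X : ∀ i, Ω' → γ i} (hX : ∀ i, Measurable (X i))
    (h : iIndepFun X P') : iIndepFun (fun i ω => X i (T ω)) P := by
  have hXT : ∀ i, Measurable fun ω => X i (T ω) := fun i => (hX i).comp hT.measurable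
  rw [iIndepFun_iff_map_fun_eq_infinitePi_map hX] at h
  rw [iIndepFun_iff_map_fun_eq_infinitePi_map hXT]
  have h1 : P.map (fun ω i => X i (T ω)) = P'.map fun ω i => X i ω := by
    rw [← hT.map_eq, Measure.map_map (measurable_pi_iff.2 hX) hT.measurable]
    rfl
  have h2 : ∀ i, P.map (fun ω => X i (T ω)) = P'.map (X i) := fun i => by
    rw [← hT.map_eq, Measure.map_map (hX i) hT.measurable]
    rfl
  rw [h1, h]
  simp only [h2]

lemma indepFun_comp_measurePreserving (hT : MeasurePreserving T P P') {γ δ : Type*}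
    [MeasurableSpace γ] [MeasurableSpace δ] {X : Ω' → γ} {Y : Ω' → δ} (hX : Measurable X)
    (hY : Measurable Y) (h : IndepFun X Y P') :
    IndepFun (fun ω => X (T ω)) (fun ω => Y (T ω)) P := by
  have hXT : Measurable fun ω => X (T ω) := hX.comp hT.measurable
  have hYT : Measurable fun ω => Y (T ω) := hY.comp hT.measurable
  rw [indepFun_iff_map_prod_eq_prod_map_map hX.aemeasurable hY.aemeasurable] at h
  rw [indepFun_iff_map_prod_eq_prod_map_map hXT.aemeasurable hYT.aemeasurable]
  have h1 : P.map (fun ω => (X (T ω), Y (T ω))) = P'.map fun ω => (X ω, Y ω) := by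
    rw [← hT.map_eq, Measure.map_map (hX.prodMk hY) hT.measurable]
    rfl
  have h2 : P.map (fun ω => X (T ω)) = P'.map X := by
    rw [← hT.map_eq, Measure.map_map hX hT.measurable]
    rfl
  have h3 : P.map (fun ω => Y (T ω)) = P'.map Y := by
    rw [← hT.map_eq, Measure.map_map hY hT.measurable]
    rfl
  rw [h1, h2, h3, h]

end Transfer

/-- The law of an outcome: `true` with probability `t`. -/
noncomputable def outcomeLaw (t : ℝ) : Measure Bool :=
  ENNReal.ofReal t • Measure.dirac true + ENNReal.ofReal (1 - t) • Measure.dirac false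

lemma isProbabilityMeasure_outcomeLaw {t : ℝ} (ht : t ∈ Set.Icc (0 : ℝ) 1) :
    IsProbabilityMeasure (outcomeLaw t) := by
  constructor
  simp only [outcomeLaw, Measure.add_apply, Measure.smul_apply, measure_univ, smul_eq_mul, mul_one]
  rw [← ENNReal.ofReal_add ht.1 (by linarith [ht.2])]
  simp

lemma outcomeLaw_true (t : ℝ) : outcomeLaw t {true} = ENNReal.ofReal t := by
  simp [outcomeLaw]

lemma iIndepFun_arrayLaw (β : Measure Bool) [IsProbabilityMeasure β] :
    iIndepFun (fun (q : ℕ × ℕ) (d : ℕ → ℕ → Bool) => d q.1 q.2) (arrayLaw β) :=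
  iIndepFun_uncurry_infinitePi' (X := fun _ _ b => b) (fun _ _ : ℕ => β) fun _ _ => measurable_id

lemma measurePreserving_arrayLaw_eval (β : Measure Bool) [IsProbabilityMeasure β] (k j : ℕ) :
    MeasurePreserving (fun d : ℕ → ℕ → Bool => d k j) (arrayLaw β) β :=
  (measurePreserving_eval_infinitePi (fun _ : ℕ => β) j).comp
    (measurePreserving_eval_infinitePi (fun _ : ℕ => Measure.infinitePi fun _ : ℕ => β) k)

/-- The rectangle `[0, T₁] × [0, T₂]`. -/
def rectangle (T₁ T₂ : ℝ) : Set (ℝ × ℝ) := Set.Icc 0 T₁ ×ˢ Set.Icc 0 T₂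

lemma measurableSet_rectangle (T₁ T₂ : ℝ) : MeasurableSet (rectangle T₁ T₂) :=
  measurableSet_Icc.prod measurableSet_Icc

lemma volume_rectangle (T₁ T₂ : ℝ) :
    volume (rectangle T₁ T₂) = ENNReal.ofReal T₁ * ENNReal.ofReal T₂ := by
  rw [rectangle, Measure.volume_eq_prod, Measure.prod_prod]
  simp

lemma volume_vertical_line (a : ℝ) : volume {p : ℝ × ℝ | p.1 = a} = 0 := by
  have : {p : ℝ × ℝ | p.1 = a} = {a} ×ˢ Set.univ := by
    ext p
    simp
  rw [this, Measure.volume_eq_prod, Measure.prod_prod]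
  simp

/-- The uniform distribution on the rectangle. -/
noncomputable def uniformLaw (T₁ T₂ : ℝ) : Measure (ℝ × ℝ) := cond volume (rectangle T₁ T₂)

lemma isProbabilityMeasure_uniformLaw {T₁ T₂ : ℝ} (hT₁ : 0 < T₁) (hT₂ : 0 < T₂) :
    IsProbabilityMeasure (uniformLaw T₁ T₂) :=
  cond_isProbabilityMeasure_of_finite (by simp [volume_rectangle, hT₁, hT₂])
    (by simp [volume_rectangle, ENNReal.mul_eq_top])

lemma uniformLaw_vertical_line (T₁ T₂ a : ℝ) : uniformLaw T₁ T₂ {p | p.1 = a} = 0 := by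
  rw [uniformLaw, cond_apply (measurableSet_rectangle _ _),
    measure_mono_null Set.inter_subset_right (volume_vertical_line a), mul_zero]

lemma volume_toNNReal_mul_uniformLaw {T₁ T₂ : ℝ} (hT₁ : 0 < T₁) (hT₂ : 0 < T₂)
    (B : Set (ℝ × ℝ)) :
    (volume (rectangle T₁ T₂)).toNNReal * (uniformLaw T₁ T₂ B).toNNReal =
      (volume (B ∩ rectangle T₁ T₂)).toNNReal := by
  rw [uniformLaw, cond_apply (measurableSet_rectangle _ _), ← ENNReal.toNNReal_mul, ← mul_assoc,
    ENNReal.mul_inv_cancel, one_mul, Set.inter_comm]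
  · simp [volume_rectangle, hT₁, hT₂]
  · simp [volume_rectangle, ENNReal.mul_eq_top]

lemma ae_uniformLaw_fst_pos (T₁ T₂ : ℝ) : ∀ᵐ p ∂uniformLaw T₁ T₂, 0 < p.1 := by
  have h1 : ∀ᵐ p ∂uniformLaw T₁ T₂, p ∈ rectangle T₁ T₂ :=
    Measure.ae_smul_measure (ae_restrict_mem (measurableSet_rectangle _ _)) _
  have h2 : ∀ᵐ p ∂uniformLaw T₁ T₂, p.1 ≠ 0 := by
    rw [ae_iff]
    simpa using uniformLaw_vertical_line T₁ T₂ 0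
  filter_upwards [h1, h2] with p hp h0
  exact lt_of_le_of_ne hp.1.1 h0.symm

lemma ae_uniformLaw_fst_notMem (T₁ T₂ : ℝ) (C : Finset ℝ) :
    ∀ᵐ p ∂uniformLaw T₁ T₂, p.1 ∉ C := by
  have : ∀ᵐ p ∂uniformLaw T₁ T₂, ∀ c ∈ C, p.1 ≠ c := by
    refine (Filter.eventually_all_finset C).2 fun c _ => ?_
    rw [ae_iff]
    simpa using uniformLaw_vertical_line T₁ T₂ c
  filter_upwards [this] with p hp hC
  exact hp _ hC rfl

section Construction

variable (t T₁ T₂ : ℝ) [IsProbabilityMeasure (outcomeLaw t)]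
  [IsProbabilityMeasure (uniformLaw T₁ T₂)]

/-- The probability space of the coupling: a Poisson number of uniform points, and independent
outcomes. -/
noncomputable def couplingLaw : Measure ((ℕ × (ℕ → ℝ × ℝ)) × (ℕ → ℕ → Bool)) :=
  (pointsLaw (volume (rectangle T₁ T₂)).toNNReal (uniformLaw T₁ T₂)).prod (arrayLaw (outcomeLaw t))

instance : IsProbabilityMeasure (couplingLaw t T₁ T₂) := by
  unfold couplingLaw
  infer_instance

variable {t T₁ T₂}

lemma measurePreserving_fst_couplingLaw : MeasurePreserving Prod.fst (couplingLaw t T₁ T₂)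
    (pointsLaw (volume (rectangle T₁ T₂)).toNNReal (uniformLaw T₁ T₂)) :=
  measurePreserving_fst

lemma ae_couplingLaw {Q : (ℕ → ℝ × ℝ) → Prop}
    (hQ : ∀ᵐ u ∂(Measure.infinitePi fun _ : ℕ => uniformLaw T₁ T₂), Q u) :
    ∀ᵐ ω ∂couplingLaw t T₁ T₂, Q ω.1.2 :=
  measurePreserving_fst_couplingLaw.quasiMeasurePreserving.ae
    ((measurePreserving_snd (μ := poissonMeasure (volume (rectangle T₁ T₂)).toNNReal)
      ).quasiMeasurePreserving.ae hQ)

lemma isPoissonProcess_firstPoints (hT₁ : 0 < T₁) (hT₂ : 0 < T₂) :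
    IsPoissonProcess T₁ T₂ (couplingLaw t T₁ T₂) fun ω => firstPoints ω.1.1 ω.1.2 := by
  have hinj : ∀ᵐ ω ∂couplingLaw t T₁ T₂, Function.Injective ω.1.2 :=
    ae_couplingLaw ((ae_fst_injective (uniformLaw_vertical_line T₁ T₂)).mono
      fun u hu i j h => hu (congrArg Prod.fst h))
  have hae : ∀ B, (fun ω => multCount B ω.1) =ᵐ[couplingLaw t T₁ T₂]
      fun ω => count (firstPoints ω.1.1 ω.1.2) B := fun B =>
    hinj.mono fun ω hω => (count_firstPoints_eq_multCount hω B).symm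
  refine ⟨fun B hB => (measurable_count_firstPoints hB).comp measurable_fst, fun B hB => ?_,
    fun n B hB hd => ?_⟩
  · rw [← Measure.map_congr (hae B)]
    have : (couplingLaw t T₁ T₂).map (fun ω => multCount B ω.1) =
        (pointsLaw (volume (rectangle T₁ T₂)).toNNReal (uniformLaw T₁ T₂)).map (multCount B) := by
      rw [← (measurePreserving_fst_couplingLaw (t := t)).map_eq,
        Measure.map_map (measurable_multCount hB) measurable_fst]
      rfl
    rw [this, map_multCount hB, volume_toNNReal_mul_uniformLaw hT₁ hT₂]
    rfl
  · exact (iIndepFun_comp_measurePreserving measurePreserving_fst_couplingLaw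
      (fun i => measurable_multCount (hB i)) (iIndepFun_multCount hB hd)).congr fun i => hae (B i)

/-- The `t`-PNG model obtained by transforming the array of outcomes in a measure preserving way
that may depend on the nucleations. -/
noncomputable def transformedModel (hT₁ : 0 < T₁) (hT₂ : 0 < T₂) (sources sinks : Finset ℝ)
    (Φ : ℕ × (ℕ → ℝ × ℝ) → (ℕ → ℕ → Bool) → ℕ → ℕ → Bool) (hΦ : Measurable (Function.uncurry Φ))
    (hlaw : ∀ ν, (arrayLaw (outcomeLaw t)).map (Φ ν) = arrayLaw (outcomeLaw t)) :
    Model t T₁ T₂ sources sinks (couplingLaw t T₁ T₂) :=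
  have hskew : MeasurePreserving (fun ω => (ω.1, Φ ω.1 ω.2)) (couplingLaw t T₁ T₂)
      (couplingLaw t T₁ T₂) :=
    (MeasurePreserving.id _).skew_product hΦ (ae_of_all _ hlaw)
  have harray : MeasurePreserving (fun ω => Φ ω.1 ω.2) (couplingLaw t T₁ T₂)
      (arrayLaw (outcomeLaw t)) :=
    measurePreserving_snd.comp hskew
  { nuc := fun ω => firstPoints ω.1.1 ω.1.2
    outcome := fun k j ω => Φ ω.1 ω.2 k j
    nuc_poisson := isPoissonProcess_firstPoints hT₁ hT₂
    outcome_measurable := fun k j =>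
      ((measurePreserving_arrayLaw_eval (outcomeLaw t) k j).comp harray).measurable
    outcome_law := fun k j => by
      have h := ((measurePreserving_arrayLaw_eval (outcomeLaw t) k j).comp harray).measure_preimage
        (measurableSet_singleton true).nullMeasurableSet
      rw [outcomeLaw_true] at h
      exact h
    outcome_indep := iIndepFun_comp_measurePreserving harray
      (X := fun (q : ℕ × ℕ) (d : ℕ → ℕ → Bool) => d q.1 q.2)
      (fun q => (measurePreserving_arrayLaw_eval (outcomeLaw t) q.1 q.2).measurable)
      (iIndepFun_arrayLaw _)
    nuc_outcome_indep := by
      have hX : Measurable fun (ν : ℕ × (ℕ → ℝ × ℝ)) (B : {B : Set (ℝ × ℝ) // MeasurableSet B}) =>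
          count (firstPoints ν.1 ν.2) B :=
        measurable_pi_iff.2 fun B => measurable_count_firstPoints B.2
      have hY : Measurable fun (d : ℕ → ℕ → Bool) (q : ℕ × ℕ) => d q.1 q.2 :=
        measurable_pi_iff.2 fun q =>
          (measurePreserving_arrayLaw_eval (outcomeLaw t) q.1 q.2).measurable
      exact indepFun_comp_measurePreserving hskew (hX.comp measurable_fst) (hY.comp measurable_snd)
        (indepFun_prod hX hY) }

end Construction

lemma not_pos_of_flag_eq_false {nuc : Finset (ℝ × ℝ)} {ξ ξ' : Finset ℝ} {p : ℝ × Bool}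
    (hp : p ∈ flaggedLines nuc ξ ξ') (h : p.2 = false) : ¬ 0 < p.1 := by
  obtain ⟨p', hp', rfl⟩ := List.mem_map.1 hp
  rw [mem_startingPoints, mem_startSet] at hp'
  simp only [decide_eq_false_iff_not, mem_startSet] at h
  have : p'.1 = 0 := by tauto
  simp [this]

/-- Maps of arrays of outcomes that depend on the nucleations through their order pattern only. -/
lemma measurable_of_nucPattern {ζ₀ ξ' : Finset ℝ}
    {Φ : ℕ × (ℕ → ℝ × ℝ) → (ℕ → ℕ → Bool) → ℕ → ℕ → Bool} (hΦ : ∀ ν, Measurable (Φ ν))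
    (h : ∀ n u u', nucPattern n ζ₀ ξ' u = nucPattern n ζ₀ ξ' u' → Φ (n, u) = Φ (n, u')) :
    Measurable (Function.uncurry Φ) := by
  have h1 : Measurable fun x : ℕ × ((ℕ → ℝ × ℝ) × (ℕ → ℕ → Bool)) => Φ (x.1, x.2.1) x.2.2 :=
    measurable_from_prod_countable_right fun n =>
      measurable_uncurry_of_countable (F := fun u => Φ (n, u)) (measurable_nucPattern n ζ₀ ξ')
        (fun u => hΦ (n, u)) (h n)
  exact h1.comp MeasurableEquiv.prodAssoc.measurable

lemma isGeneric_mk {n : ℕ} {u : ℕ → ℝ × ℝ} {η₀ ζ₀ ξ : Finset ℝ} {c : ℕ → ℕ → Bool} (hη : η₀ ⊆ ζ₀)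
    (hζ : ∀ x ∈ ζ₀, 0 < x) (hξ : ∀ s ∈ ξ, 0 < s) (hpos : ∀ i, 0 < (u i).1)
    (hmem : ∀ i, (u i).1 ∉ ζ₀) (hinj : Function.Injective fun i => (u i).1) :
    (Picture.mk η₀ ξ (firstPoints n u) c).IsGeneric where
  sources_pos x hx := hζ x (hη hx)
  sinks_pos := hξ
  nuc_pos p hp := by
    obtain ⟨i, -, rfl⟩ := Finset.mem_image.1 hp
    exact hpos i
  nuc_notMem p hp := by
    obtain ⟨i, -, rfl⟩ := Finset.mem_image.1 hp
    exact fun h => hmem i (hη h)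
  nuc_inj p hp p' hp' h := by
    obtain ⟨i, -, rfl⟩ := Finset.mem_image.1 hp
    obtain ⟨j, -, rfl⟩ := Finset.mem_image.1 hp'
    exact congrArg u (hinj h)

/-- The coupling: two models on one probability space whose pictures are almost surely in general
position and are built from common nucleations and a common array of outcomes. -/
theorem exists_coupling {t T₁ T₂ : ℝ} (ht : t ∈ Set.Icc (0 : ℝ) 1) (hT₁ : 0 < T₁) (hT₂ : 0 < T₂)
    {η₀ ζ₀ ξ ξ' : Finset ℝ} (hζ : ∀ x ∈ ζ₀, x ∈ Set.Ioc 0 T₁) (hξ' : ∀ s ∈ ξ', s ∈ Set.Ioc 0 T₂)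
    (hη : η₀ ⊆ ζ₀) (hξ : ξ ⊆ ξ') :
    ∃ (Ω : Type) (_ : MeasurableSpace Ω) (P : Measure Ω) (_ : IsProbabilityMeasure P)
      (M : Model t T₁ T₂ η₀ ξ' P) (M' : Model t T₁ T₂ ζ₀ ξ P),
      ∀ᵐ ω ∂P, ∃ nuc d, M.picture ω = subPicture η₀ ζ₀ ξ ξ' nuc d ∧
        M'.picture ω = superPicture ζ₀ ξ ξ' nuc d ∧
        (M.picture ω).IsGeneric ∧ (M'.picture ω).IsGeneric := by
  have := isProbabilityMeasure_outcomeLaw ht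
  have := isProbabilityMeasure_uniformLaw hT₁ hT₂
  have hsub : ∀ ν : ℕ × (ℕ → ℝ × ℝ), MeasurePreserving
      (fun d => subOutcome d (flaggedLines (firstPoints ν.1 ν.2) ξ ξ') η₀ ζ₀)
      (arrayLaw (outcomeLaw t)) (arrayLaw (outcomeLaw t)) := fun ν =>
    measurePreserving_subOutcome _ _ hη fun p hp => not_pos_of_flag_eq_false hp
  have hsuper : ∀ ν : ℕ × (ℕ → ℝ × ℝ), MeasurePreserving
      (fun d => superOutcome d (flaggedLines (firstPoints ν.1 ν.2) ξ ξ'))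
      (arrayLaw (outcomeLaw t)) (arrayLaw (outcomeLaw t)) := fun ν =>
    measurePreserving_superOutcome _ _
  refine ⟨_, inferInstance, couplingLaw t T₁ T₂, inferInstance,
    transformedModel hT₁ hT₂ η₀ ξ'
      (fun ν d => subOutcome d (flaggedLines (firstPoints ν.1 ν.2) ξ ξ') η₀ ζ₀)
      (measurable_of_nucPattern (fun ν => (hsub ν).measurable) fun n u u' h =>
        funext fun d => (outcome_eq_of_nucPattern_eq hη hξ h d).1)
      fun ν => (hsub ν).map_eq,
    transformedModel hT₁ hT₂ ζ₀ ξ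
      (fun ν d => superOutcome d (flaggedLines (firstPoints ν.1 ν.2) ξ ξ'))
      (measurable_of_nucPattern (fun ν => (hsuper ν).measurable) fun n u u' h =>
        funext fun d => (outcome_eq_of_nucPattern_eq hη hξ h d).2)
      fun ν => (hsuper ν).map_eq, ?_⟩
  filter_upwards [ae_couplingLaw (t := t) (ae_fst_injective (uniformLaw_vertical_line T₁ T₂)),
    ae_couplingLaw (t := t) (ae_forall_points (ae_uniformLaw_fst_pos T₁ T₂)),
    ae_couplingLaw (t := t) (ae_forall_points (ae_uniformLaw_fst_notMem T₁ T₂ ζ₀))]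
    with ω hinj hpos hmem
  exact ⟨firstPoints ω.1.1 ω.1.2, ω.2, rfl, rfl,
    isGeneric_mk hη (fun x hx => (hζ x hx).1) (fun s hs => (hξ' s hs).1) hpos hmem hinj,
    isGeneric_mk subset_rfl (fun x hx => (hζ x hx).1) (fun s hs => (hξ' s (hξ hs)).1) hpos hmem
      hinj⟩

end TPNG

theorem mainTheorem10 (t T₁ T₂ : ℝ) (ht : t ∈ Set.Icc (0 : ℝ) 1) (hT₁ : 0 < T₁) (hT₂ : 0 < T₂) :
    -- adding sources
    (∀ η₀ ζ₀ ξ : Finset ℝ, (∀ x ∈ ζ₀, x ∈ Set.Ioc 0 T₁) → (∀ s ∈ ξ, s ∈ Set.Ioc 0 T₂) →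
      η₀ ⊆ ζ₀ →
      ∃ (Ω : Type) (_ : MeasurableSpace Ω) (P : Measure Ω) (_ : IsProbabilityMeasure P)
        (η : TPNG.Model t T₁ T₂ η₀ ξ P) (ζ : TPNG.Model t T₁ T₂ ζ₀ ξ P),
        (∀ᵐ ω ∂P, ∀ τ ∈ Set.Icc 0 T₂, η.hammersley τ ω ⊆ ζ.hammersley τ ω) ∧
        (∀ᵐ ω ∂P, TPNG.HeightLE T₁ T₂ (η.picture ω) (ζ.picture ω))) ∧
    -- adding sinks
    (∀ η₀ ξ ξ' : Finset ℝ, (∀ x ∈ η₀, x ∈ Set.Ioc 0 T₁) → (∀ s ∈ ξ', s ∈ Set.Ioc 0 T₂) →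
      ξ ⊆ ξ' →
      ∃ (Ω : Type) (_ : MeasurableSpace Ω) (P : Measure Ω) (_ : IsProbabilityMeasure P)
        (η : TPNG.Model t T₁ T₂ η₀ ξ P) (η' : TPNG.Model t T₁ T₂ η₀ ξ' P),
        (∀ᵐ ω ∂P, ∀ τ ∈ Set.Icc 0 T₂,
          ((η.hammersley τ ω).card : ℤ) - (((ξ' \ ξ).filter (fun s => s ≤ τ)).card : ℤ) ≤
            ((η'.hammersley τ ω).card : ℤ)) ∧
        (∀ᵐ ω ∂P, TPNG.HeightLE T₁ T₂ (η.picture ω) (η'.picture ω))) := by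
  refine ⟨fun η₀ ζ₀ ξ hζ hξ hη => ?_, fun η₀ ξ ξ' hη₀ hξ' hξ => ?_⟩
  · obtain ⟨Ω, mΩ, P, hP, M, M', h⟩ :=
      TPNG.exists_coupling ht hT₁ hT₂ hζ hξ hη (subset_refl ξ)
    refine ⟨Ω, mΩ, P, hP, M, M', h.mono ?_, h.mono ?_⟩
    · rintro ω ⟨nuc, d, h₁, h₂, -⟩ τ -
      rw [TPNG.Model.hammersley, TPNG.Model.hammersley, h₁, h₂]
      exact (TPNG.particles_subPicture hη (subset_refl ξ) nuc d τ).1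
    · rintro ω ⟨nuc, d, h₁, h₂, hg₁, hg₂⟩
      rw [h₁] at hg₁ ⊢
      rw [h₂] at hg₂ ⊢
      exact TPNG.heightLE_subPicture hη nuc d hg₁ hg₂ T₁ T₂
  · -- the model with the additional sinks is the one with fewer particles
    obtain ⟨Ω, mΩ, P, hP, M, M', h⟩ :=
      TPNG.exists_coupling ht hT₁ hT₂ hη₀ hξ' (subset_refl η₀) hξ
    refine ⟨Ω, mΩ, P, hP, M', M, h.mono ?_, h.mono ?_⟩
    · rintro ω ⟨nuc, d, h₁, h₂, -⟩ τ -
      rw [TPNG.Model.hammersley, TPNG.Model.hammersley, h₁, h₂]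
      obtain ⟨hsub, hcard⟩ := TPNG.particles_subPicture (subset_refl η₀) hξ nuc d τ
      rw [Finset.card_sdiff_of_subset hsub] at hcard
      simp only [sdiff_self, Finset.bot_eq_empty, Finset.card_empty, zero_add] at hcard
      omega
    · rintro ω ⟨nuc, d, h₁, h₂, hg₁, hg₂⟩
      rw [h₁] at hg₁ ⊢
      rw [h₂] at hg₂ ⊢
      exact TPNG.heightLE_superPicture hξ nuc d hg₁ hg₂ T₁ T₂
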